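/- Notation. Let $\mathbb H^+=\{w\in\mathbb C:\operatorname{Re}w\ge 0\}$, let $z=x+iy\in\mathbb H^+$ be identified with the point $(x,y,0)\in\mathbb R^3$, let $R_\phi$ be the rotation of $\mathbb R^3$ by the angle $\phi$ about the second coordinate axis, and put $\Gamma(A)=\{R_\phi z: z\in A,\ 0\le\phi<2\pi\}$ for $A\subset\mathbb H^+$. For $0<s<1$ let $$\mathcal K_s(z,w)=\frac1{2\pi}\int_0^{2\pi}\frac{d\phi}{|R_\phi z-w|^s},\qquad \mathcal K_s^*(z,w)=\tfrac12\big(\mathcal K_s(z,w)+\mathcal K_s(z,\overline w)\big),\qquad \Delta_s=\Delta_s(x,z')=\mathcal K_s(x,z')-\mathcal K_s^*(z',z').$$ For a compact set $A$ in the open right half-plane, $\lambda_{s,A}$ denotes the $\mathcal K_s$-equilibrium measure of $A$, i.e. the Borel probability measure on $A$ that minimizes $\iint\mathcal K_s\,d\nu\,d\nu$ over all Borel probability measures $\nu$ on $A$; for a compact $B\subset\mathbb R^3$ of positive $s$-capacity, $\mu_{s,B}$ denotes the Riesz $s$-equilibrium measure of $B$, which minimizes $\iint|p-q|^{-s}\,d\nu(p)\,d\nu(q)$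 over all Borel probability measures $\nu$ on $B$. The outer boundary of a compact set is the boundary of the unbounded connected component of its complement. For $0<s<1$, $x>0$ and $z'$ with $\operatorname{Re}z'>0$, call a set $A$ admissible for $(s,x,z')$ if $A$ is a compact subset of the open right half-plane, $\mathcal K_s(x,w)\ge\mathcal K_s(x,z')$ for all $w\in A$, and $x,z',\overline{z'}\in A$. Theorem 3.4 (3-point Theorem). (a) Let $0<s<1$, $x>0$, $\operatorname{Re}z'>0$, and let $A$ be admissible for $(s,x,z')$. If $\Delta_s>0$, then $x\notin\operatorname{supp}\lambda_{s,A}$. (b) Let $x>0$ and $z'=1+i\gamma$ with $\gamma>0$, and suppose that $$4\left(\gamma+\sqrt{1+\gamma^2}\right)>\left(\sqrt{(1+x)^2+\gamma^2}+\sqrt{(1-x)^2+\gamma^2}\right)^2 .$$ Then there is $s_0\in(0,1]$ such that for every $0<s<s_0$ one has $\Delta_s>0$, and hence $x\notin\operatorname{supp}\lambda_{s,A}$ for every $A$ admissible for $(s,x,z')$. (c) Let $x=1/2$ and $z'=1+i/2$. Then for every $0<s<1/3$ one has $\Delta_s>0$, and hence $1/2\notin\operatorname{supp}\lambda_{s,A}$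 for every $A$ admissible for $(s,x,z')$. For example, if $A$ is the closed rectangle with lower left corner $1/2-i/2$ and upper right corner $1+i/2$, then for every $0<s<1/3$ the point $1/2$ is not in $\operatorname{supp}\lambda_{s,A}$ and $\operatorname{supp}\lambda_{s,A}$ is a proper subset of the outer boundary of $A$ (in the plane); and the support of the Riesz $s$-equilibrium measure $\mu_{s,\Gamma(A)}$ of the washer $\Gamma(A)\subset\mathbb R^3$ is a proper subset of the outer boundary of $\Gamma(A)$. -/

import Mathlib

open MeasureTheory
open scoped ENNReal

namespace ThreePoint

noncomputable section

/-- The point of the reference half-plane `{y₂ = 0, y₀ ≥ 0}` of `ℝ³` that corresponds to the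
complex number `z = x + i y`. The axis of revolution is the second coordinate axis. -/
def meridian (z : ℂ) : EuclideanSpace ℝ (Fin 3) := !₂[z.re, z.im, 0]

/-- The rotation of `ℝ³` by the angle `φ` about the second coordinate axis. -/
def rot (φ : ℝ) (p : EuclideanSpace ℝ (Fin 3)) : EuclideanSpace ℝ (Fin 3) :=
  !₂[p 0 * Real.cos φ - p 2 * Real.sin φ, p 1, p 0 * Real.sin φ + p 2 * Real.cos φ]

/-- The set of revolution `Γ(A)` in `ℝ³` generated by `A`. -/
def revolve (A : Set ℂ) : Set (EuclideanSpace ℝ (Fin 3)) :=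
  {p | ∃ z ∈ A, ∃ φ ∈ Set.Ico (0 : ℝ) (2 * Real.pi), p = rot φ (meridian z)}

/-- The kernel `K_s(z, w) = (2π)⁻¹ ∫₀^{2π} |R_φ z - w|^{-s} dφ`. -/
def kernelK (s : ℝ) (z w : ℂ) : ℝ :=
  (2 * Real.pi)⁻¹ * ∫ φ in (0 : ℝ)..(2 * Real.pi), 1 / ‖rot φ (meridian z) - meridian w‖ ^ s

/-- The symmetrized kernel `K_s^*(z, w) = (K_s(z, w) + K_s(z, conj w)) / 2`. -/
def kernelKStar (s : ℝ) (z w : ℂ) : ℝ :=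
  (kernelK s z w + kernelK s z (starRingEnd ℂ w)) / 2

/-- The quantity `Δ_s = K_s(x, z') - K_s^*(z', z')`. -/
def Delta (s x : ℝ) (z' : ℂ) : ℝ := kernelK s (x : ℂ) z' - kernelKStar s z' z'

/-- The Riesz kernel `1 / |p - q|^s` on `ℝ³` (for `s > 0`), equal to `∞` on the diagonal. -/
def rieszKernel (s : ℝ) (p q : EuclideanSpace ℝ (Fin 3)) : ℝ≥0∞ :=
  (ENNReal.ofReal ‖p - q‖) ^ (-s)

/-- The energy `∬ k(x, y) dμ(x) dμ(y)`. -/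
def energy {X : Type*} [MeasurableSpace X] (k : X → X → ℝ≥0∞) (μ : Measure X) : ℝ≥0∞ :=
  ∫⁻ x, ∫⁻ y, k x y ∂μ ∂μ

/-- `μ` is an equilibrium measure on `A` for the kernel `k`: a probability measure carried by `A`
whose energy is least among all probability measures carried by `A`. -/
structure IsEquilibriumMeasure {X : Type*} [MeasurableSpace X] (k : X → X → ℝ≥0∞) (A : Set X)
    (μ : Measure X) : Prop where
  isProbabilityMeasure : IsProbabilityMeasure μ
  carried : μ Aᶜ = 0
  minimal : ∀ ν : Measure X, IsProbabilityMeasure ν → ν Aᶜ = 0 → energy k μ ≤ energy k ν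

/-- `lam` is the `K_s`-equilibrium measure on the plane set `A`. -/
def IsKEquilibriumMeasure (s : ℝ) (A : Set ℂ) (lam : Measure ℂ) : Prop :=
  IsEquilibriumMeasure (fun z w => ENNReal.ofReal (kernelK s z w)) A lam

/-- `μ` is the Riesz `s`-equilibrium measure on the set `B` in `ℝ³`. -/
def IsRieszEquilibriumMeasure (s : ℝ) (B : Set (EuclideanSpace ℝ (Fin 3)))
    (μ : Measure (EuclideanSpace ℝ (Fin 3))) : Prop :=
  IsEquilibriumMeasure (rieszKernel s) B μ

/-- The outer boundary of a compact set `B`: the boundary of the unbounded connected component of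
its complement. -/
def outerBoundary {X : Type*} [PseudoMetricSpace X] (B : Set X) : Set X :=
  frontier {p | p ∈ Bᶜ ∧ ¬ Bornology.IsBounded (connectedComponentIn Bᶜ p)}

/-- The sets `A` of the three-point configuration `x`, `z'`, `conj z'`: compact subsets of the open
right half-plane on which `K_s(x, ·) ≥ K_s(x, z')`, containing the three points. -/
structure IsAdmissible (s x : ℝ) (z' : ℂ) (A : Set ℂ) : Prop where
  isCompact : IsCompact A
  re_pos : ∀ w ∈ A, 0 < w.re
  kernel_ge : ∀ w ∈ A, kernelK s (x : ℂ) z' ≤ kernelK s (x : ℂ) w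
  mem_x : (x : ℂ) ∈ A
  mem_z : z' ∈ A
  mem_conj : starRingEnd ℂ z' ∈ A

/-- The closed rectangle with lower left corner `1/2 - i/2` and upper right corner `1 + i/2`. Its
set of revolution is the washer. -/
def washerSection : Set ℂ :=
  {w | w.re ∈ Set.Icc (1 / 2 : ℝ) 1 ∧ w.im ∈ Set.Icc (-(1 / 2) : ℝ) (1 / 2)}

end

end ThreePoint

namespace ThreePoint

/-! ### Mean values over the circle -/

/-! Criterion (a). Write `U` for the `K_s`-potential of an equilibrium measure `λ` and `I` for its
energy. First variation gives `U ≥ I` on all of `A`, because point masses have finite `K_s`-energy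
when `s < 1` (`energy_le_pot`). With lower semicontinuity, `U ≤ I` on the support (`pot_le_energy`).
If `x` were in the support, then `K_s(x,z') ≤ U(x) ≤ I ≤ K_s^*(z',z')`. The first inequality is
admissibility, and the last compares `λ` with the half-half mixture of point masses at `z'` and its
conjugate. This contradicts `Δ_s > 0`.

Sign of `Δ_s`. Put `t = s/2`. Squared distances to an orbit have the form `a - b cos φ = c |1 - ρ
e^{iφ}|²`, so `K_s = c^{-t} M_t(ρ)`, where Parseval and the binomial series give `M_t(ρ)` as a sum
of squares. Hence `1 + t²ρ² ≤ M_t(ρ) ≤ 1 + O(t²)`, with an explicit error term. To first order in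
`t`, `Δ_s` is `t (½ log c₂ - log c₁)`, where `c₁` belongs to the pair `x, z'` and `c₂` to the pair
`z'`, conjugate of `z'`. The hypothesis of (b) says `c₁² < c₂`. For (c), numerical bounds make the
estimate effective up to `t = 1/6`.

Proper inclusion. For `0 < s < 1` the Laplacian of `|p|^{-s}` in space is negative away from the
origin, so potentials have no local minima where they are finite (`exists_pot_lt`). At an interior
point of `A` in the support, the potential of the spun measure would be at most `I`, while nearby it
is at least `I`: a local minimum. So the support lies in the boundary, and it misses `1/2`.

In space, the Riesz kernel is a mixture of products of Gaussians, hence positive definite. Averaging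
over rotations therefore does not raise energy, and the projection of a Riesz equilibrium measure of
`Γ(A)` is a `K_s`-equilibrium measure of `A` (`map_proj`). The planar result then transfers. -/

lemma integral_cos_int_mul (k : ℤ) :
    ∫ φ in (0 : ℝ)..(2 * Real.pi), Real.cos (k * φ) = if k = 0 then 2 * Real.pi else 0 := by
  split_ifs with h
  · simp [h]
  · have hk : (k : ℝ) ≠ 0 := by exact_mod_cast h
    rw [intervalIntegral.integral_comp_mul_left (fun x => Real.cos x) hk, integral_cos]
    have : Real.sin (k * (2 * Real.pi)) = 0 := by
      have := Real.sin_int_mul_pi (2 * k)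
      push_cast at this
      rw [← this]; ring_nf
    simp [this]

/-- **Parseval's identity** for an absolutely convergent one-sided trigonometric series. -/
theorem hasSum_sq_of_hasSum_exp {c : ℕ → ℝ} (hc : Summable fun n => |c n|) {f : ℝ → ℂ}
    (hf : ∀ φ : ℝ, HasSum (fun n : ℕ => (c n : ℂ) * Complex.exp (n * φ * Complex.I)) (f φ)) :
    HasSum (fun n => c n ^ 2)
      ((2 * Real.pi)⁻¹ * ∫ φ in (0 : ℝ)..(2 * Real.pi), ‖f φ‖ ^ 2) := by
  have hpi : (2 * Real.pi) ≠ 0 := by positivity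
  have hcc : Summable fun p : ℕ × ℕ => |c p.1| * |c p.2| :=
    hc.mul_of_nonneg hc (fun _ => abs_nonneg _) (fun _ => abs_nonneg _)
  have hpt : ∀ φ : ℝ, HasSum (fun p : ℕ × ℕ =>
      c p.1 * c p.2 * Real.cos (((p.1 : ℤ) - (p.2 : ℤ) : ℤ) * φ)) (‖f φ‖ ^ 2) := by
    intro φ
    have h1 := hf φ
    have h2 : HasSum (fun n : ℕ => (starRingEnd ℂ) ((c n : ℂ) * Complex.exp (n * φ * Complex.I)))
        ((starRingEnd ℂ) (f φ)) :=
      (Complex.hasSum_conj (f := fun n : ℕ => (starRingEnd ℂ)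
        ((c n : ℂ) * Complex.exp (n * φ * Complex.I)))).1 (by simpa using h1)
    have hn : ∀ n : ℕ, ‖(c n : ℂ) * Complex.exp (n * φ * Complex.I)‖ = |c n| := by
      intro n
      rw [norm_mul, show (n : ℂ) * φ * Complex.I = ((n * φ : ℝ) : ℂ) * Complex.I by push_cast; ring,
        Complex.norm_exp_ofReal_mul_I]
      simp
    have hs : Summable fun p : ℕ × ℕ => ((c p.1 : ℂ) * Complex.exp (p.1 * φ * Complex.I)) *
        (starRingEnd ℂ) ((c p.2 : ℂ) * Complex.exp (p.2 * φ * Complex.I)) := by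
      refine Summable.of_norm ?_
      refine hcc.congr fun p => ?_
      rw [norm_mul, RCLike.norm_conj, hn, hn]
    have h3 := h1.mul h2 hs
    have h4 := Complex.hasSum_re h3
    rw [Complex.mul_conj, Complex.ofReal_re, Complex.normSq_eq_norm_sq] at h4
    refine h4.congr_fun ?_
    intro p
    rw [map_mul, ← Complex.exp_conj, Complex.conj_ofReal]
    have : (c p.1 : ℂ) * Complex.exp (p.1 * φ * Complex.I) *
        ((c p.2 : ℂ) * Complex.exp ((starRingEnd ℂ) (p.2 * φ * Complex.I))) =
        ((c p.1 * c p.2 : ℝ) : ℂ) *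
          Complex.exp (((((p.1 : ℤ) - (p.2 : ℤ) : ℤ) * φ : ℝ) : ℂ) * Complex.I) := by
      rw [mul_mul_mul_comm, ← Complex.exp_add]
      push_cast
      simp only [map_mul, Complex.conj_natCast, Complex.conj_ofReal, Complex.conj_I]
      ring_nf
    rw [this, Complex.re_ofReal_mul, Complex.exp_ofReal_mul_I_re]
  have hint : HasSum (fun p : ℕ × ℕ => ∫ φ in (0 : ℝ)..(2 * Real.pi),
      c p.1 * c p.2 * Real.cos (((p.1 : ℤ) - (p.2 : ℤ) : ℤ) * φ))
      (∫ φ in (0 : ℝ)..(2 * Real.pi), ‖f φ‖ ^ 2) := by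
    refine intervalIntegral.hasSum_integral_of_dominated_convergence
      (fun p _ => |c p.1| * |c p.2|) ?_ ?_ ?_ ?_ ?_
    · intro p
      exact Continuous.aestronglyMeasurable (by fun_prop)
    · intro p
      refine ae_of_all _ fun φ _ => ?_
      rw [norm_mul, norm_mul, Real.norm_eq_abs, Real.norm_eq_abs, Real.norm_eq_abs]
      exact mul_le_of_le_one_right (by positivity) (Real.abs_cos_le_one _)
    · exact ae_of_all _ fun φ _ => hcc
    · exact intervalIntegrable_const
    · exact ae_of_all _ fun φ _ => hpt φ
  have hval : ∀ p : ℕ × ℕ, (∫ φ in (0 : ℝ)..(2 * Real.pi),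
      c p.1 * c p.2 * Real.cos (((p.1 : ℤ) - (p.2 : ℤ) : ℤ) * φ)) =
      (if p.1 = p.2 then c p.1 * c p.2 * (2 * Real.pi) else 0) := by
    intro p
    rw [intervalIntegral.integral_const_mul, integral_cos_int_mul]
    by_cases h : p.1 = p.2
    · simp [h]
    · have : ((p.1 : ℤ) - (p.2 : ℤ)) ≠ 0 := by
        intro h'; exact h (by exact_mod_cast sub_eq_zero.1 h')
      simp only [this, h, if_false, mul_zero]
  simp only [hval] at hint
  -- Only the diagonal terms survive integration, so the double series is re-indexed along `n ↦ (n,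
  -- n)`.
  have hinj : Function.Injective fun n : ℕ => (n, n) := fun a b h => (Prod.mk.inj h).1
  have := (hinj.hasSum_iff (f := fun p : ℕ × ℕ =>
    if p.1 = p.2 then c p.1 * c p.2 * (2 * Real.pi) else 0) (by
      rintro ⟨a, b⟩ hab
      have : a ≠ b := fun h => hab ⟨a, by simp [h]⟩
      simp [this])).2 hint
  have h5 := this.mul_left ((2 * Real.pi)⁻¹)
  refine h5.congr_fun ?_
  intro n
  simp only [Function.comp, if_true]
  field_simp

/-- The coefficients of `(1 - z)^{-t}`. -/
noncomputable def binomCoeff (t : ℝ) (n : ℕ) : ℝ := (ascPochhammer ℝ n).eval t / n.factorial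

@[simp] lemma binomCoeff_zero (t : ℝ) : binomCoeff t 0 = 1 := by simp [binomCoeff]

lemma binomCoeff_succ (t : ℝ) (n : ℕ) :
    binomCoeff t (n + 1) = binomCoeff t n * ((t + n) / (n + 1)) := by
  simp only [binomCoeff, ascPochhammer_succ_eval, Nat.factorial_succ]
  push_cast
  have : (n.factorial : ℝ) ≠ 0 := by positivity
  have : (n : ℝ) + 1 ≠ 0 := by positivity
  field_simp

lemma choose_eq_binomCoeff (t : ℝ) (n : ℕ) :
    Ring.choose ((t : ℂ) + n - 1) n = (binomCoeff t n : ℂ) := by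
  have h : Ring.choose (t + n - 1) n = binomCoeff t n := by
    rw [Ring.choose, show t + n - 1 - n + 1 = t by ring, binomCoeff]
    have := Ring.factorial_nsmul_multichoose_eq_ascPochhammer t n
    rw [Polynomial.ascPochhammer_smeval_eq_eval, nsmul_eq_mul] at this
    have h0 : (n.factorial : ℝ) ≠ 0 := by positivity
    rw [← this]
    field_simp
  rw [← h, Complex.ofReal_choose]
  push_cast
  rfl

lemma hasSum_binomCoeff (t : ℝ) {z : ℂ} (hz : ‖z‖ < 1) :
    HasSum (fun n : ℕ => (binomCoeff t n : ℂ) * z ^ n) (1 / (1 - z) ^ (t : ℂ)) := by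
  have := (Complex.one_div_one_sub_cpow_hasFPowerSeriesOnBall_zero (t : ℂ)).hasSum
    (y := z) (by simpa [enorm_eq_nnnorm, ← NNReal.coe_lt_one] using hz)
  simpa [choose_eq_binomCoeff, FormalMultilinearSeries.ofScalars_apply_eq, mul_comm] using this

lemma binomCoeff_nonneg {t : ℝ} (ht : 0 ≤ t) (n : ℕ) : 0 ≤ binomCoeff t n := by
  induction n with
  | zero => simp
  | succ n ih => rw [binomCoeff_succ]; positivity

lemma norm_one_sub_sq (r φ : ℝ) :
    ‖1 - (r : ℂ) * Complex.exp (φ * Complex.I)‖ ^ 2 = 1 - 2 * r * Real.cos φ + r ^ 2 := by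
  rw [← Complex.normSq_eq_norm_sq, Complex.normSq_apply]
  simp only [Complex.sub_re, Complex.one_re, Complex.re_ofReal_mul, Complex.exp_ofReal_mul_I_re,
    Complex.sub_im, Complex.one_im, Complex.im_ofReal_mul, Complex.exp_ofReal_mul_I_im]
  nlinarith [Real.sin_sq_add_cos_sq φ]

/-- The mean value over the circle of `|1 - r e^{iφ}|^{-2t}`. -/
theorem hasSum_circleMean (t : ℝ) {r : ℝ} (hr0 : 0 ≤ r) (hr : r < 1) :
    HasSum (fun n => (binomCoeff t n * r ^ n) ^ 2)
      ((2 * Real.pi)⁻¹ * ∫ φ in (0 : ℝ)..(2 * Real.pi),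
        (1 - 2 * r * Real.cos φ + r ^ 2) ^ (-t)) := by
  have hz : ∀ φ : ℝ, ‖(r : ℂ) * Complex.exp (φ * Complex.I)‖ = r := by
    intro φ
    rw [norm_mul, Complex.norm_exp_ofReal_mul_I, Complex.norm_real, Real.norm_of_nonneg hr0, mul_one]
  have hc : Summable fun n : ℕ => |binomCoeff t n * r ^ n| := by
    have := (hasSum_binomCoeff t (z := (r : ℂ)) (by simpa [abs_of_nonneg hr0] using hr)).summable.norm
    refine this.congr fun n => ?_
    rw [norm_mul, norm_pow, Complex.norm_real, Complex.norm_real, abs_mul, abs_pow]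
    simp only [Real.norm_eq_abs]
  have := hasSum_sq_of_hasSum_exp hc
    (f := fun φ : ℝ => 1 / (1 - (r : ℂ) * Complex.exp (φ * Complex.I)) ^ (t : ℂ)) (by
      intro φ
      refine (hasSum_binomCoeff t (by rw [hz]; exact hr)).congr_fun ?_
      intro n
      rw [mul_pow, ← Complex.exp_nat_mul]
      push_cast
      ring_nf)
  convert this using 2
  refine intervalIntegral.integral_congr fun φ _ => ?_
  simp only [norm_div, norm_one, Complex.norm_cpow_real]
  rw [← norm_one_sub_sq, Real.rpow_neg (by positivity), ← Real.rpow_natCast _ 2,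
    ← Real.rpow_natCast _ 2, ← Real.rpow_mul (norm_nonneg _), Nat.cast_ofNat, mul_comm (2 : ℝ) t,
    Real.rpow_mul (norm_nonneg _), Real.div_rpow zero_le_one (by positivity), Real.one_rpow, one_div]

/-- A telescoping estimate. The squared coefficients decay like `n^{2t-2}`, so the tail past `N` is
about `N/(1 - 2t)` times the `N`-th square; this fixes the slope of the weight. Its constant term is
chosen so that the step from `N = 0` to `N = 1` is an equality. The left side is then nonincreasing
in `N`, and the right side is its value at `N = 0`. -/
lemma sum_binomCoeff_sq_add_le {t : ℝ} (ht0 : 0 ≤ t) (ht : t < 1 / 2) (N : ℕ) :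
    ∑ n ∈ Finset.range (N + 1), binomCoeff t n ^ 2 +
      (1 / (1 - 2 * t) * (N + 1) + 2 * (1 - t) / ((1 - 2 * t) * (3 + t))) *
        binomCoeff t (N + 1) ^ 2 ≤ 1 + t ^ 2 * (5 - t) / ((1 - 2 * t) * (3 + t)) := by
  have h1 : 0 < 1 - 2 * t := by linarith
  have h3 : 0 < 3 + t := by linarith
  induction N with
  | zero =>
    rw [binomCoeff_succ]
    simp only [zero_add, Finset.range_one, Finset.sum_singleton, binomCoeff_zero]
    apply le_of_eq
    push_cast
    field_simp
    ring
  | succ N ih =>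
    refine le_trans ?_ ih
    rw [Finset.sum_range_succ, binomCoeff_succ t (N + 1), add_assoc, mul_pow]
    have hA : 0 ≤ binomCoeff t (N + 1) ^ 2 := sq_nonneg _
    push_cast
    have hm : (0 : ℝ) ≤ N := Nat.cast_nonneg N
    have key : 1 + (1 / (1 - 2 * t) * (N + 1 + 1) + 2 * (1 - t) / ((1 - 2 * t) * (3 + t))) *
        ((t + (N + 1)) / (N + 1 + 1)) ^ 2 ≤
        1 / (1 - 2 * t) * (N + 1) + 2 * (1 - t) / ((1 - 2 * t) * (3 + t)) := by
      have : 1 / (1 - 2 * t) * (N + 1) + 2 * (1 - t) / ((1 - 2 * t) * (3 + t)) -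
        (1 + (1 / (1 - 2 * t) * (N + 1 + 1) + 2 * (1 - t) / ((1 - 2 * t) * (3 + t))) *
        ((t + (N + 1)) / (N + 1 + 1)) ^ 2) =
          (1 - t) ^ 3 * N / ((1 - 2 * t) * (3 + t) * (N + 1 + 1) ^ 2) := by
        field_simp
        ring
      have h2 : 0 ≤ (1 - t) ^ 3 * N / ((1 - 2 * t) * (3 + t) * (N + 1 + 1) ^ 2) := by
        have : 0 ≤ 1 - t := by linarith
        positivity
      linarith
    nlinarith [mul_le_mul_of_nonneg_left key hA]

lemma sum_binomCoeff_sq_le {t : ℝ} (ht0 : 0 ≤ t) (ht : t < 1 / 2) (N : ℕ) :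
    ∑ n ∈ Finset.range N, binomCoeff t n ^ 2 ≤
      1 + t ^ 2 * (5 - t) / ((1 - 2 * t) * (3 + t)) := by
  have h1 : 0 < 1 - 2 * t := by linarith
  have h3 : 0 < 3 + t := by linarith
  have h4 : 0 ≤ 1 - t := by linarith
  refine le_trans ?_ (sum_binomCoeff_sq_add_le ht0 ht N)
  rw [Finset.sum_range_succ, add_assoc]
  have : 0 ≤ (1 / (1 - 2 * t) * (N + 1) + 2 * (1 - t) / ((1 - 2 * t) * (3 + t))) *
        binomCoeff t (N + 1) ^ 2 := by positivity
  nlinarith [sq_nonneg (binomCoeff t N)]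

lemma circleMean_le_of_lt {t : ℝ} (ht0 : 0 ≤ t) (ht : t < 1 / 2) {r : ℝ} (hr0 : 0 ≤ r)
    (hr : r < 1) :
    (2 * Real.pi)⁻¹ * ∫ φ in (0 : ℝ)..(2 * Real.pi), (1 - 2 * r * Real.cos φ + r ^ 2) ^ (-t) ≤
      1 + t ^ 2 * (5 - t) / ((1 - 2 * t) * (3 + t)) := by
  refine le_of_tendsto' (hasSum_circleMean t hr0 hr).tendsto_sum_nat fun N => ?_
  refine le_trans (Finset.sum_le_sum fun n _ => ?_) (sum_binomCoeff_sq_le ht0 ht N)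
  have h0 := binomCoeff_nonneg ht0 n
  have h1 : r ^ n ≤ 1 := pow_le_one₀ hr0 hr.le
  gcongr
  exact mul_le_of_le_one_right h0 h1

lemma le_circleMean (t : ℝ) {r : ℝ} (hr0 : 0 ≤ r) (hr : r < 1) :
    1 + t ^ 2 * r ^ 2 ≤
      (2 * Real.pi)⁻¹ * ∫ φ in (0 : ℝ)..(2 * Real.pi), (1 - 2 * r * Real.cos φ + r ^ 2) ^ (-t) := by
  have := sum_le_hasSum (Finset.range 2) (fun n _ => sq_nonneg _) (hasSum_circleMean t hr0 hr)
  refine le_trans (le_of_eq ?_) this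
  rw [Finset.sum_range_succ, Finset.sum_range_one, binomCoeff_succ]
  simp
  ring

lemma one_sub_two_mul_cos_nonneg (r φ : ℝ) : 0 ≤ 1 - 2 * r * Real.cos φ + r ^ 2 := by
  nlinarith [Real.sin_sq_add_cos_sq φ, sq_nonneg (r - Real.cos φ), sq_nonneg (Real.sin φ)]

lemma one_sub_two_mul_cos_pos {r : ℝ} (hr0 : 0 ≤ r) (hr : r < 1) (φ : ℝ) :
    0 < 1 - 2 * r * Real.cos φ + r ^ 2 := by
  nlinarith [Real.cos_le_one φ, sq_pos_of_pos (sub_pos.2 hr), mul_nonneg hr0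
    (sub_nonneg.2 (Real.cos_le_one φ))]

lemma intervalIntegrable_circle_of_lt (t : ℝ) {r : ℝ} (hr0 : 0 ≤ r) (hr : r < 1) :
    IntervalIntegrable (fun φ => (1 - 2 * r * Real.cos φ + r ^ 2) ^ (-t)) volume
      0 (2 * Real.pi) := by
  refine Continuous.intervalIntegrable ?_ _ _
  refine Continuous.rpow_const (by fun_prop) fun φ => Or.inl ?_
  exact (one_sub_two_mul_cos_pos hr0 hr φ).ne'

/-- Fatou's lemma as `r → 1` carries the uniform bound to the singular case `r = 1`, and
integrability comes with it. -/
lemma lintegral_circle_one_le {t : ℝ} (ht0 : 0 ≤ t) (ht : t < 1 / 2) :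
    ∫⁻ φ in Set.Ioc 0 (2 * Real.pi), ENNReal.ofReal ((2 - 2 * Real.cos φ) ^ (-t)) ≤
      ENNReal.ofReal (2 * Real.pi * (1 + t ^ 2 * (5 - t) / ((1 - 2 * t) * (3 + t)))) := by
  set r : ℕ → ℝ := fun n => 1 - 1 / ((n : ℝ) + 1) with hr
  have hr0 : ∀ n, 0 ≤ r n := by
    intro n
    have : 1 / ((n : ℝ) + 1) ≤ 1 := by
      rw [div_le_one (by positivity)]; linarith [(Nat.cast_nonneg n : (0 : ℝ) ≤ n)]
    simp only [hr]; linarith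
  have hr1 : ∀ n, r n < 1 := by
    intro n
    have : 0 < 1 / ((n : ℝ) + 1) := by positivity
    simp only [hr]; linarith
  have hrt : Filter.Tendsto r Filter.atTop (nhds 1) := by
    have := (tendsto_const_nhds (x := (1 : ℝ))).sub (tendsto_one_div_add_atTop_nhds_zero_nat (𝕜 := ℝ))
    simpa [hr] using this
  have hF : ∀ n, Measurable fun φ : ℝ =>
      ENNReal.ofReal ((1 - 2 * r n * Real.cos φ + r n ^ 2) ^ (-t)) := by
    intro n; fun_prop
  calc _ ≤ ∫⁻ φ in Set.Ioc 0 (2 * Real.pi), Filter.liminf (fun n =>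
        ENNReal.ofReal ((1 - 2 * r n * Real.cos φ + r n ^ 2) ^ (-t))) Filter.atTop := by
        refine lintegral_mono fun φ => ?_
        -- At the singular angles the real power `0 ^ (-t)` is `0` by convention when `t ≠ 0`, so
        -- the inequality is trivial there.
        rcases eq_or_ne (2 - 2 * Real.cos φ) 0 with h | h
        · rcases eq_or_lt_of_le ht0 with h0 | h0
          · subst h0; simp
          · simp only [h]
            rw [Real.zero_rpow (by linarith)]; simp
        · refine le_of_eq (Filter.Tendsto.liminf_eq ?_).symm
          refine (ENNReal.continuous_ofReal.tendsto _).comp ?_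
          have h1 : Filter.Tendsto (fun n => 1 - 2 * r n * Real.cos φ + r n ^ 2) Filter.atTop
              (nhds (2 - 2 * Real.cos φ)) := by
            have : Filter.Tendsto (fun n => 1 - 2 * r n * Real.cos φ + r n ^ 2) Filter.atTop
              (nhds (1 - 2 * 1 * Real.cos φ + 1 ^ 2)) :=
              (tendsto_const_nhds.sub ((hrt.const_mul 2).mul_const _)).add (hrt.pow 2)
            convert this using 2; ring
          exact h1.rpow_const (Or.inl h)
    _ ≤ Filter.liminf (fun n => ∫⁻ φ in Set.Ioc 0 (2 * Real.pi),
        ENNReal.ofReal ((1 - 2 * r n * Real.cos φ + r n ^ 2) ^ (-t))) Filter.atTop :=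
        lintegral_liminf_le hF
    _ ≤ _ := by
        refine Filter.liminf_le_of_le (by isBoundedDefault) fun b hb => ?_
        obtain ⟨n, hn⟩ := hb.exists
        refine hn.trans ?_
        have hi := intervalIntegrable_circle_of_lt t (hr0 n) (hr1 n)
        rw [intervalIntegrable_iff_integrableOn_Ioc_of_le (by positivity)] at hi
        rw [← ofReal_integral_eq_lintegral_ofReal hi
          (ae_of_all _ fun φ => Real.rpow_nonneg (one_sub_two_mul_cos_nonneg _ _) _)]
        refine ENNReal.ofReal_le_ofReal ?_
        rw [← intervalIntegral.integral_of_le (by positivity)]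
        have := circleMean_le_of_lt ht0 ht (hr0 n) (hr1 n)
        rwa [inv_mul_le_iff₀ (by positivity)] at this

lemma intervalIntegrable_circle_one {t : ℝ} (ht0 : 0 ≤ t) (ht : t < 1 / 2) :
    IntervalIntegrable (fun φ => (2 - 2 * Real.cos φ) ^ (-t)) volume 0 (2 * Real.pi) := by
  rw [intervalIntegrable_iff_integrableOn_Ioc_of_le (by positivity)]
  refine ⟨Measurable.aestronglyMeasurable (by fun_prop), ?_⟩
  rw [hasFiniteIntegral_iff_ofReal (ae_of_all _ fun φ => Real.rpow_nonneg
    (by linarith [Real.cos_le_one φ]) _)]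
  exact (lintegral_circle_one_le ht0 ht).trans_lt ENNReal.ofReal_lt_top

lemma circleMean_one_le {t : ℝ} (ht0 : 0 ≤ t) (ht : t < 1 / 2) :
    (2 * Real.pi)⁻¹ * ∫ φ in (0 : ℝ)..(2 * Real.pi), (2 - 2 * Real.cos φ) ^ (-t) ≤
      1 + t ^ 2 * (5 - t) / ((1 - 2 * t) * (3 + t)) := by
  rw [inv_mul_le_iff₀ (by positivity), intervalIntegral.integral_of_le (by positivity),
    integral_eq_lintegral_of_nonneg_ae (ae_of_all _ fun φ => Real.rpow_nonneg
    (by linarith [Real.cos_le_one φ]) _) (Measurable.aestronglyMeasurable (by fun_prop))]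
  refine ENNReal.toReal_le_of_le_ofReal ?_ (lintegral_circle_one_le ht0 ht)
  have h1 : 0 < 1 - 2 * t := by linarith
  have h2 : 0 ≤ 5 - t := by linarith
  positivity

/-- `a - b cos φ` is a multiple of `|1 - ρ e^{iφ}|²`. -/
lemma sub_mul_cos_eq {a b c : ℝ} (hc : c ≠ 0) (h : c + b ^ 2 / (4 * c) = a) (φ : ℝ) :
    a - b * Real.cos φ =
      c * (1 - 2 * (b / (2 * c)) * Real.cos φ + (b / (2 * c)) ^ 2) := by
  rw [← h]; field_simp; ring

lemma ringMean_eq {a b c : ℝ} (t : ℝ) (hc : 0 < c) (h : c + b ^ 2 / (4 * c) = a) :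
    (2 * Real.pi)⁻¹ * ∫ φ in (0 : ℝ)..(2 * Real.pi), (a - b * Real.cos φ) ^ (-t) =
      c ^ (-t) * ((2 * Real.pi)⁻¹ * ∫ φ in (0 : ℝ)..(2 * Real.pi),
        (1 - 2 * (b / (2 * c)) * Real.cos φ + (b / (2 * c)) ^ 2) ^ (-t)) := by
  have : ∀ φ : ℝ, (a - b * Real.cos φ) ^ (-t) = c ^ (-t) *
      (1 - 2 * (b / (2 * c)) * Real.cos φ + (b / (2 * c)) ^ 2) ^ (-t) := fun φ => by
    rw [sub_mul_cos_eq hc.ne' h, Real.mul_rpow hc.le (one_sub_two_mul_cos_nonneg _ _)]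
  simp only [this, intervalIntegral.integral_const_mul]
  ring

/-! ### The kernel in closed form and the sign of `Δ_s` -/

lemma norm_rot_meridian_sub_sq (z w : ℂ) (φ : ℝ) :
    ‖rot φ (meridian z) - meridian w‖ ^ 2 =
      (z.re ^ 2 + w.re ^ 2 + (z.im - w.im) ^ 2) - 2 * z.re * w.re * Real.cos φ := by
  rw [EuclideanSpace.real_norm_sq_eq, Fin.sum_univ_three]
  simp only [rot, meridian, PiLp.sub_apply, PiLp.toLp_apply, Matrix.cons_val_zero,
    Matrix.cons_val_one, Matrix.cons_val]
  nlinarith [Real.sin_sq_add_cos_sq φ]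

lemma one_div_norm_rpow (z w : ℂ) (s φ : ℝ) :
    1 / ‖rot φ (meridian z) - meridian w‖ ^ s =
      ((z.re ^ 2 + w.re ^ 2 + (z.im - w.im) ^ 2) - 2 * z.re * w.re * Real.cos φ) ^ (-(s / 2)) := by
  rw [← norm_rot_meridian_sub_sq, ← Real.rpow_natCast _ 2, ← Real.rpow_mul (norm_nonneg _), one_div,
    ← Real.rpow_neg (norm_nonneg _)]
  congr 1
  push_cast; ring

lemma kernelK_eq (s : ℝ) (z w : ℂ) :
    kernelK s z w = (2 * Real.pi)⁻¹ * ∫ φ in (0 : ℝ)..(2 * Real.pi),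
      ((z.re ^ 2 + w.re ^ 2 + (z.im - w.im) ^ 2) - 2 * z.re * w.re * Real.cos φ) ^ (-(s / 2)) := by
  simp only [kernelK, one_div_norm_rpow]

lemma kernelK_self_le {s γ : ℝ} (hs0 : 0 ≤ s) (hs : s < 1) :
    kernelK s ⟨1, γ⟩ ⟨1, γ⟩ ≤
      1 + (s / 2) ^ 2 * (5 - s / 2) / ((1 - 2 * (s / 2)) * (3 + s / 2)) := by
  rw [kernelK_eq]
  refine le_trans (le_of_eq ?_) (circleMean_one_le (by linarith) (by linarith))
  norm_num

/-- The two roots `P`, `Q` are the largest and smallest distances from `z'` to the orbit of `x`.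
Then `a = (P² + Q²)/2` and `b = (P² - Q²)/2`, which gives `c = (P + Q)²/4` and `ρ = (P - Q)/(P +
Q)`. -/
lemma pairSum_sq_div_four {x γ : ℝ} (hx : 0 < x) (hγ : 0 < γ) :
    (√((1 + x) ^ 2 + γ ^ 2) + √((1 - x) ^ 2 + γ ^ 2)) ^ 2 / 4 +
      (2 * x) ^ 2 / (4 * ((√((1 + x) ^ 2 + γ ^ 2) + √((1 - x) ^ 2 + γ ^ 2)) ^ 2 / 4)) =
      x ^ 2 + 1 + γ ^ 2 := by
  have hP : √((1 + x) ^ 2 + γ ^ 2) ^ 2 = (1 + x) ^ 2 + γ ^ 2 := Real.sq_sqrt (by positivity)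
  have hQ : √((1 - x) ^ 2 + γ ^ 2) ^ 2 = (1 - x) ^ 2 + γ ^ 2 := Real.sq_sqrt (by positivity)
  have hP0 : 0 < √((1 + x) ^ 2 + γ ^ 2) := Real.sqrt_pos.2 (by positivity)
  have hQ0 : 0 < √((1 - x) ^ 2 + γ ^ 2) := Real.sqrt_pos.2 (by positivity)
  set P := √((1 + x) ^ 2 + γ ^ 2)
  set Q := √((1 - x) ^ 2 + γ ^ 2)
  have h2x : 2 * x = (P ^ 2 - Q ^ 2) / 2 := by rw [hP, hQ]; ring
  have : x ^ 2 + 1 + γ ^ 2 = (P ^ 2 + Q ^ 2) / 2 := by rw [hP, hQ]; ring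
  rw [h2x, this]
  have : P + Q ≠ 0 := by positivity
  field_simp
  ring

lemma kernelK_real_ge {s x γ : ℝ} (hx : 0 < x) (hγ : 0 < γ) :
    ((√((1 + x) ^ 2 + γ ^ 2) + √((1 - x) ^ 2 + γ ^ 2)) ^ 2 / 4) ^ (-(s / 2)) ≤
      kernelK s (x : ℂ) ⟨1, γ⟩ := by
  have hc := pairSum_sq_div_four hx hγ
  have hP0 : 0 < √((1 + x) ^ 2 + γ ^ 2) := Real.sqrt_pos.2 (by positivity)
  have hQ0 : 0 < √((1 - x) ^ 2 + γ ^ 2) := Real.sqrt_pos.2 (by positivity)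
  have hP : √((1 + x) ^ 2 + γ ^ 2) ^ 2 = (1 + x) ^ 2 + γ ^ 2 := Real.sq_sqrt (by positivity)
  have hQ : √((1 - x) ^ 2 + γ ^ 2) ^ 2 = (1 - x) ^ 2 + γ ^ 2 := Real.sq_sqrt (by positivity)
  set P := √((1 + x) ^ 2 + γ ^ 2)
  set Q := √((1 - x) ^ 2 + γ ^ 2)
  have hc0 : 0 < (P + Q) ^ 2 / 4 := by positivity
  have h := ringMean_eq (s / 2) hc0 hc
  have hr : 2 * x / (2 * ((P + Q) ^ 2 / 4)) < 1 := by
    rw [div_lt_one (by positivity)]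
    nlinarith [mul_pos hP0 hQ0]
  have h1 := le_circleMean (s / 2) (by positivity) hr
  have h2 : kernelK s (x : ℂ) ⟨1, γ⟩ = (2 * Real.pi)⁻¹ * ∫ φ in (0 : ℝ)..(2 * Real.pi),
      (x ^ 2 + 1 + γ ^ 2 - 2 * x * Real.cos φ) ^ (-(s / 2)) := by
    rw [kernelK_eq]; simp
  rw [h2, h]
  refine le_mul_of_one_le_right (Real.rpow_nonneg hc0.le _) (le_trans ?_ h1)
  have : 0 ≤ (s / 2) ^ 2 * (2 * x / (2 * ((P + Q) ^ 2 / 4))) ^ 2 := by positivity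
  linarith

/-- Here the extreme distances are `2√(1 + γ²)` and `2γ`, so `c = (γ + √(1 + γ²))²`. -/
lemma kernelK_conj_le {s γ : ℝ} (hs0 : 0 ≤ s) (hs : s < 1) (hγ : 0 < γ) :
    kernelK s ⟨1, γ⟩ (starRingEnd ℂ ⟨1, γ⟩) ≤ ((γ + √(1 + γ ^ 2)) ^ 2) ^ (-(s / 2)) *
      (1 + (s / 2) ^ 2 * (5 - s / 2) / ((1 - 2 * (s / 2)) * (3 + s / 2))) := by
  have hT : √(1 + γ ^ 2) ^ 2 = 1 + γ ^ 2 := Real.sq_sqrt (by positivity)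
  have hT0 : 0 < √(1 + γ ^ 2) := Real.sqrt_pos.2 (by positivity)
  set T := √(1 + γ ^ 2)
  have hT1 : 1 < T := by nlinarith [sq_pos_of_pos hγ]
  have hc0 : 0 < (γ + T) ^ 2 := by positivity
  have hc : (γ + T) ^ 2 + 2 ^ 2 / (4 * (γ + T) ^ 2) = 2 + 4 * γ ^ 2 := by
    have h1 : (2 : ℝ) ^ 2 = 4 * (T ^ 2 - γ ^ 2) ^ 2 := by rw [hT]; ring
    have h2 : 2 + 4 * γ ^ 2 = 2 * (T ^ 2 + γ ^ 2) := by rw [hT]; ring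
    rw [h1, h2]
    have : γ + T ≠ 0 := by positivity
    field_simp
    ring
  have h := ringMean_eq (s / 2) hc0 hc
  have hr : (2 : ℝ) / (2 * (γ + T) ^ 2) < 1 := by
    rw [div_lt_one (by positivity)]; nlinarith
  have h2 : kernelK s ⟨1, γ⟩ (starRingEnd ℂ ⟨1, γ⟩) =
      (2 * Real.pi)⁻¹ * ∫ φ in (0 : ℝ)..(2 * Real.pi),
      (2 + 4 * γ ^ 2 - 2 * Real.cos φ) ^ (-(s / 2)) := by
    rw [kernelK_eq]
    simp only [Complex.conj_re, Complex.conj_im]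
    ring_nf
  rw [h2, h]
  gcongr
  exact circleMean_le_of_lt (by linarith) (by linarith) (by positivity) hr

/-- Both sides equal `1` at `t = 0`, and the error term is `O(t²)`, so the derivatives at `0`
decide; they compare `log c₁` with `½ log c₂`. The cap `1/4` on `δ` ensures that the error fraction
is at most `4t²`. -/
lemma delta_pos_aux {c₁ c₂ : ℝ} (h1 : 0 < c₁) (h2 : 0 < c₂) (h : c₁ ^ 2 < c₂) :
    ∃ δ > 0, δ ≤ 1 / 4 ∧ ∀ t : ℝ, 0 < t → t < δ →
      (1 + c₂ ^ (-t)) * (1 + t ^ 2 * (5 - t) / ((1 - 2 * t) * (3 + t))) / 2 < c₁ ^ (-t) := by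
  have hd : HasDerivAt (fun t : ℝ => c₁ ^ (-t) - (1 + c₂ ^ (-t)) * (1 + 4 * t ^ 2) / 2)
      (Real.log c₂ / 2 - Real.log c₁) 0 := by
    have e1 : HasDerivAt (fun t : ℝ => c₁ ^ (-t)) (-Real.log c₁) 0 := by
      simpa using (hasDerivAt_neg (0 : ℝ)).const_rpow h1
    have e2 : HasDerivAt (fun t : ℝ => c₂ ^ (-t)) (-Real.log c₂) 0 := by
      simpa using (hasDerivAt_neg (0 : ℝ)).const_rpow h2
    have e3 : HasDerivAt (fun t : ℝ => 1 + 4 * t ^ 2) 0 0 := by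
      simpa using ((hasDerivAt_pow 2 (0 : ℝ)).const_mul 4).const_add 1
    have := e1.sub (((e2.const_add 1).mul e3).div_const 2)
    refine HasDerivAt.congr_deriv this ?_
    simp only [neg_zero, Real.rpow_zero]
    ring
  have hpos : 0 < Real.log c₂ / 2 - Real.log c₁ := by
    have := Real.log_lt_log (by positivity) h
    rw [Real.log_pow] at this
    push_cast at this
    linarith
  have hs := hasDerivAt_iff_tendsto_slope.1 hd
  have hev := hs.eventually (lt_mem_nhds hpos)
  rw [eventually_nhdsWithin_iff, Metric.eventually_nhds_iff] at hev
  obtain ⟨δ, hδ, H⟩ := hev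
  refine ⟨min δ (1 / 4), by positivity, min_le_right _ _, fun t ht0 ht => ?_⟩
  have htδ := lt_of_lt_of_le ht (min_le_left _ _)
  have ht4 := lt_of_lt_of_le ht (min_le_right _ _)
  have := H (y := t) (by simpa [abs_of_pos ht0] using htδ) (by simpa using ht0.ne')
  rw [slope_def_field] at this
  simp only [neg_zero, Real.rpow_zero, sub_zero] at this
  rw [lt_div_iff₀ ht0] at this
  have hB : t ^ 2 * (5 - t) / ((1 - 2 * t) * (3 + t)) ≤ 4 * t ^ 2 := by
    have : 0 < 1 - 2 * t := by linarith
    rw [div_le_iff₀ (by positivity)]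
    have : 5 - t ≤ 4 * ((1 - 2 * t) * (3 + t)) := by nlinarith
    nlinarith [mul_le_mul_of_nonneg_left this (sq_nonneg t)]
  have hc : 0 ≤ 1 + c₂ ^ (-t) := by positivity
  nlinarith [mul_le_mul_of_nonneg_left hB hc]

lemma exists_delta_pos {x γ : ℝ} (hx : 0 < x) (hγ : 0 < γ)
    (h : (√((1 + x) ^ 2 + γ ^ 2) + √((1 - x) ^ 2 + γ ^ 2)) ^ 2 < 4 * (γ + √(1 + γ ^ 2))) :
    ∃ s₀ : ℝ, 0 < s₀ ∧ s₀ ≤ 1 ∧ ∀ s : ℝ, 0 < s → s < s₀ → 0 < Delta s x (⟨1, γ⟩ : ℂ) := by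
  have hP0 : 0 < √((1 + x) ^ 2 + γ ^ 2) := Real.sqrt_pos.2 (by positivity)
  obtain ⟨δ, hδ, hδ4, H⟩ := delta_pos_aux
    (c₁ := (√((1 + x) ^ 2 + γ ^ 2) + √((1 - x) ^ 2 + γ ^ 2)) ^ 2 / 4)
    (c₂ := (γ + √(1 + γ ^ 2)) ^ 2) (by positivity) (by positivity) (by
      gcongr
      linarith)
  refine ⟨2 * δ, by positivity, by linarith, fun s hs0 hs => ?_⟩
  have h1 := H (s / 2) (by positivity) (by linarith)
  have h2 := kernelK_real_ge (s := s) hx hγ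
  have h3 := kernelK_self_le (γ := γ) hs0.le (by linarith : s < 1)
  have h4 := kernelK_conj_le hs0.le (by linarith : s < 1) hγ
  rw [Delta, kernelKStar]
  nlinarith

/-- The three factors on the right are lower bounds for `2 - 2^{-t}`, for `((3 + √5)/4)^{-t}` and
for the circle mean; the denominator of the upper bound for `K_s(z',z')` has been cleared. -/
lemma delta_pos_polynomial {t : ℝ} (h0 : 0 < t) (h1 : t < 1 / 6) :
    (1 - 2 * t) * (3 + t) + t ^ 2 * (5 - t) <
    (1 + (0.693 * t) - (0.693 * t) ^ 2 / 2) *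
      (1 - 0.2693 * t + (0.2693 * t) ^ 2 / 2 - (0.2693 * t) ^ 3 / 4) * (1 + 0.1458 * t ^ 2) *
      ((1 - 2 * t) * (3 + t)) := by
  -- Up to rounding and terms beyond `t⁴`, the difference of the two sides is `t` times this cubic.
  -- Its value at `t = 1/6` is only about `0.01`, which is why the constants need this precision.
  have hq : 0 < 1.271 - 7.8526 * t + 1.82 * t ^ 2 - 0.462 * t ^ 3 := by
    nlinarith [mul_pos h0 (sub_pos.2 h1), mul_pos (mul_pos h0 h0) (sub_pos.2 h1),
      mul_pos (sub_pos.2 h1) (sub_pos.2 h1), pow_pos h0 3]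
  have h5 := pow_pos h0 5
  have h6 := pow_pos h0 6
  have h8 := pow_pos h0 8
  have hsq : 0 < 1 - t ^ 2 := by nlinarith
  nlinarith [mul_pos h0 hq, mul_pos h5 hsq, mul_pos h0 h0, pow_pos h0 3, pow_pos h0 4,
    mul_pos (pow_pos h0 7) hsq]

lemma log_golden_le : Real.log ((3 + √5) / 4) ≤ 0.2693 := by
  have h5 : √5 ≤ 2.236068 := Real.sqrt_le_iff.2 ⟨by norm_num, by norm_num⟩
  have h50 : 0 ≤ √5 := Real.sqrt_nonneg 5
  rw [Real.log_le_iff_le_exp (by positivity)]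
  have := Real.sum_le_exp_of_nonneg (x := 0.2693) (by norm_num) 5
  refine le_trans ?_ this
  norm_num [Finset.sum_range_succ, Nat.factorial]
  linarith

lemma exp_neg_le_quadratic {y : ℝ} (hy : 0 ≤ y) : Real.exp (-y) ≤ 1 - y + y ^ 2 / 2 := by
  have h := Real.quadratic_le_exp_of_nonneg hy
  rw [Real.exp_neg, inv_le_iff_one_le_mul₀ (Real.exp_pos y)]
  have h2 : 0 < 1 - y + y ^ 2 / 2 := by nlinarith [sq_nonneg (y - 1)]
  nlinarith [mul_le_mul_of_nonneg_left h h2.le, sq_nonneg (y ^ 2)]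

lemma cubic_le_exp_neg {y : ℝ} (hy : 0 ≤ y) (hy1 : y ≤ 1) :
    1 - y + y ^ 2 / 2 - y ^ 3 / 4 ≤ Real.exp (-y) := by
  have h := Real.exp_bound (x := -y) (by rwa [abs_neg, abs_of_nonneg hy]) (n := 3) (by norm_num)
  have h1 := (abs_le.1 h).1
  rw [abs_neg, abs_of_nonneg hy] at h1
  norm_num [Finset.sum_range_succ, Nat.factorial] at h1
  nlinarith [pow_nonneg hy 3]

lemma two_sub_rpow_ge {t : ℝ} (h0 : 0 < t) :
    1 + 0.693 * t - (0.693 * t) ^ 2 / 2 ≤ 2 - (2 : ℝ) ^ (-t) := by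
  rw [Real.rpow_def_of_pos two_pos]
  have h := exp_neg_le_quadratic (y := 0.693 * t) (by positivity)
  have h2 : Real.exp (Real.log 2 * -t) ≤ Real.exp (-(0.693 * t)) := by
    refine Real.exp_le_exp.2 ?_
    nlinarith [Real.log_two_gt_d9]
  linarith

lemma golden_rpow_ge {t : ℝ} (h0 : 0 < t) (h1 : t < 1 / 6) :
    1 - 0.2693 * t + (0.2693 * t) ^ 2 / 2 - (0.2693 * t) ^ 3 / 4 ≤ ((3 + √5) / 4) ^ (-t) := by
  rw [Real.rpow_def_of_pos (by positivity)]
  refine (cubic_le_exp_neg (y := 0.2693 * t) (by positivity) (by linarith)).trans (Real.exp_le_exp.2 ?_)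
  nlinarith [log_golden_le]

/-- For this configuration the squared distances for the pair `z'`, conjugate of `z'` are `3 - 2 cos
φ`, exactly twice those for `x, z'`. Hence `2Δ_s = (2 - 2^{-t}) K_s(x,z') - K_s(z',z')`, and only
one lower bound and one upper bound are needed. -/
lemma delta_washer_pos {s : ℝ} (hs0 : 0 < s) (hs : s < 1 / 3) :
    0 < Delta s (1 / 2) (⟨1, 1 / 2⟩ : ℂ) := by
  have h5 : √5 ^ 2 = 5 := Real.sq_sqrt (by norm_num)
  have h5u : √5 ≤ 2.236068 := Real.sqrt_le_iff.2 ⟨by norm_num, by norm_num⟩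
  have h5l : 2.236067 ≤ √5 := Real.le_sqrt_of_sq_le (by norm_num)
  obtain ⟨t, rfl⟩ : ∃ t, s = 2 * t := ⟨s / 2, by ring⟩
  have ht0 : 0 < t := by linarith
  have ht : t < 1 / 6 := by linarith
  have hc0 : 0 < (3 + √5) / 4 := by positivity
  have hc : (3 + √5) / 4 + 1 ^ 2 / (4 * ((3 + √5) / 4)) = 3 / 2 := by
    field_simp
    nlinarith
  have hρ : 1 / (2 * ((3 + √5) / 4)) = (3 - √5) / 2 := by
    field_simp
    nlinarith
  have h := ringMean_eq t hc0 hc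
  rw [hρ] at h
  have hm := le_circleMean t (r := (3 - √5) / 2) (by linarith) (by linarith)
  have hρ2 : (0.1458 : ℝ) ≤ ((3 - √5) / 2) ^ 2 := by nlinarith
  have hK : ((3 + √5) / 4) ^ (-t) * (1 + 0.1458 * t ^ 2) ≤
      kernelK (2 * t) ((1 / 2 : ℝ) : ℂ) ⟨1, 1 / 2⟩ := by
    have h2 : kernelK (2 * t) ((1 / 2 : ℝ) : ℂ) ⟨1, 1 / 2⟩ =
        (2 * Real.pi)⁻¹ * ∫ φ in (0 : ℝ)..(2 * Real.pi), (3 / 2 - 1 * Real.cos φ) ^ (-t) := by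
      rw [kernelK_eq]
      norm_num
    rw [h2, h]
    gcongr
    nlinarith [mul_le_mul_of_nonneg_left hρ2 (sq_nonneg t)]
  have hconj : kernelK (2 * t) ⟨1, 1 / 2⟩ (starRingEnd ℂ ⟨1, 1 / 2⟩) =
      (2 : ℝ) ^ (-t) * kernelK (2 * t) ((1 / 2 : ℝ) : ℂ) ⟨1, 1 / 2⟩ := by
    have hφ : ∀ φ : ℝ, (3 - 2 * Real.cos φ) ^ (-t) =
        (2 : ℝ) ^ (-t) * (3 / 2 - Real.cos φ) ^ (-t) := fun φ => by
      rw [← Real.mul_rpow two_pos.le (by linarith [Real.cos_le_one φ])]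
      congr 1
      ring
    have e1 : kernelK (2 * t) ⟨1, 1 / 2⟩ (starRingEnd ℂ ⟨1, 1 / 2⟩) =
        (2 * Real.pi)⁻¹ * ∫ φ in (0 : ℝ)..(2 * Real.pi), (3 - 2 * Real.cos φ) ^ (-t) := by
      rw [kernelK_eq]
      norm_num [Complex.conj_re, Complex.conj_im]
    have e2 : kernelK (2 * t) ((1 / 2 : ℝ) : ℂ) ⟨1, 1 / 2⟩ =
        (2 * Real.pi)⁻¹ * ∫ φ in (0 : ℝ)..(2 * Real.pi), (3 / 2 - Real.cos φ) ^ (-t) := by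
      rw [kernelK_eq]
      norm_num
    rw [e1, e2]
    simp only [hφ, intervalIntegral.integral_const_mul]
    ring
  have hself := kernelK_self_le (s := 2 * t) (γ := 1 / 2) (by linarith) (by linarith)
  rw [show 2 * t / 2 = t by ring] at hself
  have h2 := two_sub_rpow_ge ht0
  have h3 := golden_rpow_ge ht0 ht
  have hpoly := delta_pos_polynomial ht0 ht
  have hden : 0 < (1 - 2 * t) * (3 + t) := mul_pos (by linarith) (by linarith)
  have hlow : 0 < 1 + 0.693 * t - (0.693 * t) ^ 2 / 2 := by nlinarith
  have hK0 : 0 ≤ kernelK (2 * t) ((1 / 2 : ℝ) : ℂ) ⟨1, 1 / 2⟩ := le_trans (by positivity) hK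
  have hR : 1 + t ^ 2 * (5 - t) / ((1 - 2 * t) * (3 + t)) <
      (1 + 0.693 * t - (0.693 * t) ^ 2 / 2) *
      (1 - 0.2693 * t + (0.2693 * t) ^ 2 / 2 - (0.2693 * t) ^ 3 / 4) * (1 + 0.1458 * t ^ 2) := by
    have e : 1 + t ^ 2 * (5 - t) / ((1 - 2 * t) * (3 + t)) =
        ((1 - 2 * t) * (3 + t) + t ^ 2 * (5 - t)) / ((1 - 2 * t) * (3 + t)) := by
      rw [add_div, div_self hden.ne']
    rw [e, div_lt_iff₀ hden]
    exact hpoly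
  have hchain : 1 + t ^ 2 * (5 - t) / ((1 - 2 * t) * (3 + t)) <
      (2 - (2 : ℝ) ^ (-t)) * kernelK (2 * t) ((1 / 2 : ℝ) : ℂ) ⟨1, 1 / 2⟩ := by
    refine hR.trans_le ?_
    rw [mul_assoc]
    exact mul_le_mul h2 ((mul_le_mul_of_nonneg_right h3 (by positivity)).trans hK)
      (mul_nonneg (by nlinarith) (by positivity)) (hlow.le.trans h2)
  rw [Delta, kernelKStar, hconj]
  linarith

/-! ### Rotations and the kernel with values in `[0, ∞]` -/

/-- Euclidean three-space. -/
abbrev E3 := EuclideanSpace ℝ (Fin 3)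

lemma norm_sq_eq_three (p : E3) : ‖p‖ ^ 2 = p 0 ^ 2 + p 1 ^ 2 + p 2 ^ 2 := by
  rw [EuclideanSpace.real_norm_sq_eq, Fin.sum_univ_three]

@[simp] lemma rot_apply_zero (φ : ℝ) (p : E3) :
    rot φ p 0 = p 0 * Real.cos φ - p 2 * Real.sin φ := rfl

@[simp] lemma rot_apply_one (φ : ℝ) (p : E3) : rot φ p 1 = p 1 := rfl

@[simp] lemma rot_apply_two (φ : ℝ) (p : E3) :
    rot φ p 2 = p 0 * Real.sin φ + p 2 * Real.cos φ := rfl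

@[simp] lemma meridian_apply_zero (z : ℂ) : meridian z 0 = z.re := rfl

@[simp] lemma meridian_apply_one (z : ℂ) : meridian z 1 = z.im := rfl

@[simp] lemma meridian_apply_two (z : ℂ) : meridian z 2 = 0 := rfl

lemma ext_three {p q : E3} (h0 : p 0 = q 0) (h1 : p 1 = q 1) (h2 : p 2 = q 2) : p = q := by
  ext i
  fin_cases i <;> assumption

lemma rot_add (φ ψ : ℝ) (p : E3) : rot (φ + ψ) p = rot φ (rot ψ p) := by
  refine ext_three ?_ ?_ ?_ <;> simp [Real.cos_add, Real.sin_add] <;> ring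

@[simp] lemma rot_zero (p : E3) : rot 0 p = p := by
  refine ext_three ?_ ?_ ?_ <;> simp

lemma norm_rot_sub_rot (φ : ℝ) (p q : E3) : ‖rot φ p - rot φ q‖ = ‖p - q‖ := by
  rw [← sq_eq_sq₀ (norm_nonneg _) (norm_nonneg _), norm_sq_eq_three, norm_sq_eq_three]
  simp only [PiLp.sub_apply, rot_apply_zero, rot_apply_one, rot_apply_two]
  nlinarith [Real.sin_sq_add_cos_sq φ]

lemma rot_add_int_mul_two_pi (k : ℤ) (φ : ℝ) (p : E3) : rot (k * (2 * Real.pi) + φ) p = rot φ p := by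
  refine ext_three ?_ ?_ ?_ <;> simp [add_comm _ φ]

lemma continuous_three {X : Type*} [TopologicalSpace X] {f : X → E3}
    (h : ∀ i, Continuous fun x => f x i) : Continuous f :=
  (PiLp.continuous_toLp 2 _).comp (continuous_pi h)

lemma continuous_rot : Continuous fun x : ℝ × E3 => rot x.1 x.2 := by
  refine continuous_three fun i => ?_
  have h : ∀ j : Fin 3, Continuous fun x : ℝ × E3 => x.2 j := fun j => by fun_prop
  fin_cases i <;> simp <;> fun_prop

lemma continuous_meridian : Continuous meridian := by
  refine continuous_three fun i => ?_
  fin_cases i <;> simp <;> fun_prop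

/-- The point of the closed half-plane on the same orbit as `p`. -/
noncomputable def proj (p : E3) : ℂ := ⟨√(p 0 ^ 2 + p 2 ^ 2), p 1⟩

lemma continuous_proj : Continuous proj := by
  have : proj = fun p => ((√(p 0 ^ 2 + p 2 ^ 2) : ℝ) : ℂ) + (p 1 : ℝ) * Complex.I := by
    ext p; apply Complex.ext <;> simp [proj]
  rw [this]
  fun_prop

@[simp] lemma proj_re (p : E3) : (proj p).re = √(p 0 ^ 2 + p 2 ^ 2) := rfl

@[simp] lemma proj_im (p : E3) : (proj p).im = p 1 := rfl

lemma proj_rot (φ : ℝ) (p : E3) : proj (rot φ p) = proj p := by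
  apply Complex.ext
  · simp only [proj_re, rot_apply_zero, rot_apply_two]
    congr 1
    nlinarith [Real.sin_sq_add_cos_sq φ]
  · simp

lemma proj_meridian {z : ℂ} (hz : 0 ≤ z.re) : proj (meridian z) = z := by
  apply Complex.ext <;> simp [Real.sqrt_sq hz]

lemma exists_rot_eq (p : E3) :
    ∃ φ ∈ Set.Ico (0 : ℝ) (2 * Real.pi), p = rot φ (meridian (proj p)) := by
  set w : ℂ := ⟨p 0, p 2⟩
  have hw : √(p 0 ^ 2 + p 2 ^ 2) = ‖w‖ := by
    rw [Complex.norm_def, Complex.normSq_apply]; congr 1; simp only [w]; ring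
  have hc : p 0 = ‖w‖ * Real.cos w.arg := (Complex.norm_mul_cos_arg w).symm
  have hs : p 2 = ‖w‖ * Real.sin w.arg := (Complex.norm_mul_sin_arg w).symm
  have key : p = rot w.arg (meridian (proj p)) := by
    refine ext_three ?_ ?_ ?_
    · simp only [rot_apply_zero, meridian_apply_zero, meridian_apply_two, proj_re, hw]; linarith
    · simp
    · simp only [rot_apply_two, meridian_apply_zero, meridian_apply_two, proj_re, hw]; linarith
  rcases le_or_gt 0 w.arg with h | h
  · exact ⟨w.arg, ⟨h, by linarith [Complex.arg_le_pi w, Real.pi_pos]⟩, key⟩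
  · refine ⟨2 * Real.pi + w.arg, ⟨by linarith [Complex.neg_pi_lt_arg w, Real.pi_pos], by linarith⟩, ?_⟩
    have := rot_add_int_mul_two_pi 1 w.arg (meridian (proj p))
    rw [Int.cast_one, one_mul] at this
    rw [this]; exact key

lemma revolve_eq {A : Set ℂ} (hA : ∀ w ∈ A, 0 < w.re) : revolve A = proj ⁻¹' A := by
  ext p
  constructor
  · rintro ⟨z, hz, φ, -, rfl⟩
    rwa [Set.mem_preimage, proj_rot, proj_meridian (hA z hz).le]
  · intro h
    obtain ⟨φ, hφ, e⟩ := exists_rot_eq p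
    exact ⟨proj p, h, φ, hφ, e⟩

lemma _root_.Measurable.rieszKernel {α : Type*} [MeasurableSpace α] {f g : α → E3}
    (hf : Measurable f) (hg : Measurable g) (s : ℝ) :
    Measurable fun x => rieszKernel s (f x) (g x) := by
  unfold ThreePoint.rieszKernel
  fun_prop

lemma rieszKernel_comm (s : ℝ) (p q : E3) : rieszKernel s p q = rieszKernel s q p := by
  rw [rieszKernel, rieszKernel, norm_sub_rev]

lemma rieszKernel_rot_rot (s φ : ℝ) (p q : E3) :
    rieszKernel s (rot φ p) (rot φ q) = rieszKernel s p q := by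
  rw [rieszKernel, rieszKernel, norm_rot_sub_rot]

lemma rieszKernel_eq_ofReal {p q : E3} (h : p ≠ q) (s : ℝ) :
    rieszKernel s p q = ENNReal.ofReal (1 / ‖p - q‖ ^ s) := by
  have : 0 < ‖p - q‖ := norm_sub_pos_iff.2 h
  rw [rieszKernel, ENNReal.ofReal_rpow_of_pos this, Real.rpow_neg this.le, one_div]

/-- The uniform probability measure on `(0, 2π]`. -/
noncomputable def angleMeasure : Measure ℝ :=
  (ENNReal.ofReal (2 * Real.pi))⁻¹ • volume.restrict (Set.Ioc 0 (2 * Real.pi))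

instance : IsProbabilityMeasure angleMeasure := by
  constructor
  have : ENNReal.ofReal (2 * Real.pi) ≠ 0 := by simp [Real.pi_pos]
  simp only [angleMeasure, Measure.smul_apply, Measure.restrict_apply_univ, Real.volume_Ioc,
    sub_zero, smul_eq_mul]
  exact ENNReal.inv_mul_cancel this ENNReal.ofReal_ne_top

lemma lintegral_angleMeasure_add {f : ℝ → ℝ≥0∞}
    (hf : ∀ (k : ℤ) (φ : ℝ), f (k * (2 * Real.pi) + φ) = f φ) (c : ℝ) :
    ∫⁻ φ, f (φ + c) ∂angleMeasure = ∫⁻ φ, f φ ∂angleMeasure := by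
  have hpi : 0 < 2 * Real.pi := by positivity
  simp only [angleMeasure, lintegral_smul_measure]
  congr 1
  have h1 : ∫⁻ φ in Set.Ioc 0 (2 * Real.pi), f (φ + c) =
      ∫⁻ φ in Set.Ioc c (c + 2 * Real.pi), f φ := by
    have := (measurePreserving_add_right volume c).setLIntegral_comp_emb
      (MeasurableEquiv.addRight c).measurableEmbedding f (Set.Ioc 0 (2 * Real.pi))
    rw [this]
    congr 2
    simp [add_comm]
  rw [h1]
  have h2 := (isAddFundamentalDomain_Ioc hpi c).setLIntegral_eq (isAddFundamentalDomain_Ioc hpi 0)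
    f (by
      rintro ⟨g, hg⟩ x
      obtain ⟨k, rfl⟩ := AddSubgroup.mem_zmultiples_iff.1 hg
      simpa [AddSubgroup.vadd_def] using hf k x)
  rw [h2, zero_add]

/-- The kernel `K_s` with values in `[0, ∞]`. -/
noncomputable def ringKernel (s : ℝ) (z w : ℂ) : ℝ≥0∞ :=
  ∫⁻ φ, rieszKernel s (rot φ (meridian z)) (meridian w) ∂angleMeasure

lemma ringKernel_comm (s : ℝ) (z w : ℂ) : ringKernel s z w = ringKernel s w z := by
  have h : ∀ φ, ‖rot φ (meridian z) - meridian w‖ = ‖rot φ (meridian w) - meridian z‖ := by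
    intro φ
    rw [← sq_eq_sq₀ (norm_nonneg _) (norm_nonneg _), norm_rot_meridian_sub_sq,
      norm_rot_meridian_sub_sq]
    ring
  simp only [ringKernel, rieszKernel, h]

lemma measurable_ringKernel (s : ℝ) : Measurable fun x : ℂ × ℂ => ringKernel s x.1 x.2 := by
  unfold ringKernel
  refine Measurable.lintegral_prod_right' (f := fun y : (ℂ × ℂ) × ℝ =>
    rieszKernel s (rot y.2 (meridian y.1.1)) (meridian y.1.2)) ?_
  refine Measurable.rieszKernel ?_ ?_ s
  · exact (continuous_rot.comp (continuous_snd.prodMk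
      (continuous_meridian.comp (continuous_fst.comp continuous_fst)))).measurable
  · exact (continuous_meridian.comp (continuous_snd.comp continuous_fst)).measurable

/-- Rotations are isometries and the angle is averaged uniformly, so the mean depends only on the
orbits of `p` and `q`. -/
lemma ringKernel_proj (s : ℝ) (p q : E3) :
    ringKernel s (proj p) (proj q) = ∫⁻ φ, rieszKernel s (rot φ p) q ∂angleMeasure := by
  obtain ⟨α, -, hp⟩ := exists_rot_eq p
  obtain ⟨β, -, hq⟩ := exists_rot_eq q
  have h : ∀ φ, rieszKernel s (rot φ p) q =
      rieszKernel s (rot (φ + (α - β)) (meridian (proj p))) (meridian (proj q)) := by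
    intro φ
    conv_lhs => rw [hp, hq, ← rot_add, show φ + α = β + (φ + (α - β)) by ring, rot_add,
      rieszKernel_rot_rot]
  simp only [h]
  rw [lintegral_angleMeasure_add (f := fun φ =>
    rieszKernel s (rot φ (meridian (proj p))) (meridian (proj q)))
    (fun k φ => by simp only [rot_add_int_mul_two_pi])]
  rfl

lemma kernelK_integrand_bound {a b : ℝ} (hb : 0 < b) (hab : b ≤ a) {t : ℝ} (ht : 0 ≤ t) {φ : ℝ}
    (hφ : Real.cos φ < 1) :
    (a - b * Real.cos φ) ^ (-t) ≤ (b / 2) ^ (-t) * (2 - 2 * Real.cos φ) ^ (-t) := by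
  rw [← Real.mul_rpow (by positivity) (by linarith)]
  have h1 : 0 < b / 2 * (2 - 2 * Real.cos φ) := mul_pos (by positivity) (by linarith)
  exact Real.rpow_le_rpow_of_nonpos h1 (by nlinarith) (by linarith)

lemma ae_cos_lt_one : ∀ᵐ φ ∂(volume.restrict (Set.Ioc 0 (2 * Real.pi))), Real.cos φ < 1 := by
  have h1 : ∀ᵐ φ ∂(volume.restrict (Set.Ioc 0 (2 * Real.pi))), φ ≠ 2 * Real.pi := by
    rw [ae_iff]
    simp
  filter_upwards [h1, ae_restrict_mem measurableSet_Ioc] with φ hφ hm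
  refine lt_of_le_of_ne (Real.cos_le_one φ) fun h => ?_
  have := (Real.cos_eq_one_iff_of_lt_of_lt (x := φ) (by linarith [hm.1, Real.pi_pos])
    (lt_of_le_of_ne hm.2 hφ)).1 h
  linarith [hm.1]

/-- The real kernel is a Bochner integral, which would be `0` without integrability, and its
integrand takes the value `0` where the points meet. For `s < 1` and points off the axis the
integrand is dominated by the diagonal one, and the points meet only at a null set of angles, so no
default value interferes. -/
lemma ofReal_kernelK {s : ℝ} (hs0 : 0 ≤ s) (hs : s < 1) {z w : ℂ} (hz : 0 < z.re) (hw : 0 < w.re) :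
    ENNReal.ofReal (kernelK s z w) = ringKernel s z w := by
  have hb : 0 < 2 * z.re * w.re := by positivity
  have hab : 2 * z.re * w.re ≤ z.re ^ 2 + w.re ^ 2 + (z.im - w.im) ^ 2 := by
    nlinarith [sq_nonneg (z.re - w.re), sq_nonneg (z.im - w.im)]
  have hnn : ∀ φ, 0 ≤ z.re ^ 2 + w.re ^ 2 + (z.im - w.im) ^ 2 - 2 * z.re * w.re * Real.cos φ :=
    fun φ => by rw [← norm_rot_meridian_sub_sq]; positivity
  have hi : IntegrableOn (fun φ => (z.re ^ 2 + w.re ^ 2 + (z.im - w.im) ^ 2 -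
      2 * z.re * w.re * Real.cos φ) ^ (-(s / 2))) (Set.Ioc 0 (2 * Real.pi)) := by
    have h1 := intervalIntegrable_circle_one (t := s / 2) (by linarith) (by linarith)
    rw [intervalIntegrable_iff_integrableOn_Ioc_of_le (by positivity)] at h1
    refine (h1.const_mul ((2 * z.re * w.re / 2) ^ (-(s / 2)))).mono'
      (Measurable.aestronglyMeasurable (by fun_prop)) ?_
    filter_upwards [ae_cos_lt_one] with φ hφ
    rw [Real.norm_of_nonneg (Real.rpow_nonneg (hnn φ) _)]
    exact kernelK_integrand_bound hb hab (by linarith) hφ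
  rw [kernelK_eq, ENNReal.ofReal_mul (by positivity), intervalIntegral.integral_of_le (by positivity),
    ofReal_integral_eq_lintegral_ofReal hi (ae_of_all _ fun φ => Real.rpow_nonneg (hnn φ) _),
    ENNReal.ofReal_inv_of_pos (by positivity), ringKernel, angleMeasure, lintegral_smul_measure,
    smul_eq_mul]
  congr 1
  refine lintegral_congr_ae ?_
  filter_upwards [ae_cos_lt_one] with φ hφ
  rw [← one_div_norm_rpow, rieszKernel_eq_ofReal]
  intro h
  have h1 := norm_rot_meridian_sub_sq z w φ
  rw [h, sub_self, norm_zero] at h1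
  nlinarith

lemma ringKernel_lt_top {s : ℝ} (hs0 : 0 ≤ s) (hs : s < 1) {z w : ℂ} (hz : 0 < z.re)
    (hw : 0 < w.re) : ringKernel s z w < ∞ := by
  rw [← ofReal_kernelK hs0 hs hz hw]; exact ENNReal.ofReal_lt_top

/-! ### Potentials and measures of revolution -/

/-- The Riesz potential of a measure. -/
noncomputable def pot (s : ℝ) (μ : Measure E3) (p : E3) : ℝ≥0∞ := ∫⁻ q, rieszKernel s p q ∂μ

/-- The measure of revolution generated by a measure on the half-plane. -/
noncomputable def spin (lam : Measure ℂ) : Measure E3 :=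
  (angleMeasure.prod lam).map fun x => rot x.1 (meridian x.2)

lemma measurable_rot_meridian : Measurable fun x : ℝ × ℂ => rot x.1 (meridian x.2) :=
  (continuous_rot.comp (continuous_fst.prodMk (continuous_meridian.comp continuous_snd))).measurable

instance (lam : Measure ℂ) [IsProbabilityMeasure lam] : IsProbabilityMeasure (spin lam) :=
  Measure.isProbabilityMeasure_map measurable_rot_meridian.aemeasurable

lemma lintegral_spin (lam : Measure ℂ) [SFinite lam] {f : E3 → ℝ≥0∞} (hf : Measurable f) :
    ∫⁻ p, f p ∂(spin lam) = ∫⁻ z, ∫⁻ φ, f (rot φ (meridian z)) ∂angleMeasure ∂lam := by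
  rw [spin, lintegral_map hf measurable_rot_meridian,
    lintegral_prod_symm (fun x : ℝ × ℂ => f (rot x.1 (meridian x.2)))
      (hf.comp measurable_rot_meridian).aemeasurable]

lemma measurable_rieszKernel_right (s : ℝ) (p : E3) : Measurable (rieszKernel s p) :=
  measurable_const.rieszKernel measurable_id s

lemma measurable_pot (s : ℝ) (μ : Measure E3) [SFinite μ] : Measurable (pot s μ) :=
  (measurable_fst.rieszKernel measurable_snd s).lintegral_prod_right'

lemma pot_spin {s : ℝ} (lam : Measure ℂ) [SFinite lam] (p : E3) :
    pot s (spin lam) p = ∫⁻ w, ringKernel s (proj p) w ∂lam := by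
  rw [pot, lintegral_spin lam (measurable_rieszKernel_right s p)]
  refine lintegral_congr fun w => ?_
  obtain ⟨α, -, hp⟩ := exists_rot_eq p
  rw [ringKernel_comm]
  have h : ∀ φ, rieszKernel s p (rot φ (meridian w)) =
      rieszKernel s (rot (φ + -α) (meridian w)) (meridian (proj p)) := by
    intro φ
    conv_lhs => rw [rieszKernel_comm, hp, show φ = α + (φ + -α) by ring, rot_add,
      rieszKernel_rot_rot]
  simp only [h]
  rw [lintegral_angleMeasure_add (f := fun φ =>
    rieszKernel s (rot φ (meridian w)) (meridian (proj p)))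
    (fun k φ => by simp only [rot_add_int_mul_two_pi])]
  rfl

/-- The potential of a spun measure is constant on orbits, so averaging over the angle changes
nothing. -/
lemma energy_spin {s : ℝ} (lam : Measure ℂ) [SFinite lam] {A : Set ℂ} (hA : ∀ w ∈ A, 0 < w.re)
    (hlam : lam Aᶜ = 0) : energy (rieszKernel s) (spin lam) = energy (ringKernel s) lam := by
  have : SFinite (spin lam) := by unfold spin; infer_instance
  have h : energy (rieszKernel s) (spin lam) = ∫⁻ p, pot s (spin lam) p ∂(spin lam) := rfl
  rw [h, lintegral_spin lam (measurable_pot s _), energy]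
  refine lintegral_congr_ae ?_
  filter_upwards [compl_mem_ae_iff.2 hlam] with z hz
  have hz' : 0 ≤ z.re := (hA z (by simpa using hz)).le
  simp only [pot_spin, proj_rot, proj_meridian hz', lintegral_const, measure_univ, mul_one]

lemma continuous_rieszKernel (s : ℝ) : Continuous fun x : E3 × E3 => rieszKernel s x.1 x.2 := by
  unfold rieszKernel
  exact ENNReal.continuous_rpow_const.comp (ENNReal.continuous_ofReal.comp (by fun_prop))

/-- Riesz potentials are lower semicontinuous. -/
lemma lowerSemicontinuous_pot (s : ℝ) (μ : Measure E3) : LowerSemicontinuous (pot s μ) := by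
  intro p b hb
  by_contra h
  obtain ⟨u, hu, hub⟩ := Filter.exists_seq_forall_of_frequently (Filter.not_eventually.1 h)
  have hlim : ∀ q, Filter.Tendsto (fun n => rieszKernel s (u n) q) Filter.atTop
      (nhds (rieszKernel s p q)) := fun q =>
    ((continuous_rieszKernel s).comp (continuous_id.prodMk continuous_const)).continuousAt.tendsto.comp hu
  have : pot s μ p ≤ Filter.liminf (fun n => pot s μ (u n)) Filter.atTop := by
    calc pot s μ p = ∫⁻ q, Filter.liminf (fun n => rieszKernel s (u n) q) Filter.atTop ∂μ :=
          lintegral_congr fun q => (hlim q).liminf_eq.symm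
      _ ≤ _ := lintegral_liminf_le fun n => measurable_rieszKernel_right s (u n)
  refine absurd (hb.trans_le this) (not_lt.2 ?_)
  exact Filter.liminf_le_of_le (by isBoundedDefault) fun c hc => by
    obtain ⟨n, hn⟩ := hc.exists
    exact hn.trans (not_lt.1 (hub n))

/-! ### Equilibrium measures: the variational inequality -/

section Variation

variable {X : Type*} [MeasurableSpace X] {k : X → X → ℝ≥0∞} {A : Set X} {μ : Measure X}

lemma energy_congr {k' : X → X → ℝ≥0∞} (hμ : μ Aᶜ = 0) (h : ∀ x ∈ A, ∀ y ∈ A, k x y = k' x y) :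
    energy k μ = energy k' μ := by
  have hae : ∀ᵐ x ∂μ, x ∈ A := mem_ae_iff.2 hμ
  refine lintegral_congr_ae ?_
  filter_upwards [hae] with x hx
  refine lintegral_congr_ae ?_
  filter_upwards [hae] with y hy
  exact h x hx y hy

lemma IsEquilibriumMeasure.congr {k' : X → X → ℝ≥0∞} (hμ : IsEquilibriumMeasure k A μ)
    (h : ∀ x ∈ A, ∀ y ∈ A, k x y = k' x y) : IsEquilibriumMeasure k' A μ where
  isProbabilityMeasure := hμ.isProbabilityMeasure
  carried := hμ.carried
  minimal ν hν hνA := by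
    rw [← energy_congr hμ.carried h, ← energy_congr hνA h]
    exact hμ.minimal ν hν hνA

lemma energy_smul_add_smul (hk : Measurable fun x : X × X => k x.1 x.2)
    (hsymm : ∀ x y, k x y = k y x) (μ ν : Measure X) [SFinite μ] [SFinite ν] (a b : ℝ≥0∞) :
    energy k (a • μ + b • ν) =
      a ^ 2 * energy k μ + 2 * a * b * ∫⁻ x, ∫⁻ y, k x y ∂μ ∂ν + b ^ 2 * energy k ν := by
  have h1 : Measurable fun x => ∫⁻ y, k x y ∂μ := hk.lintegral_prod_right'
  have h2 : Measurable fun x => ∫⁻ y, k x y ∂ν := hk.lintegral_prod_right'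
  have hswap : ∫⁻ x, ∫⁻ y, k x y ∂ν ∂μ = ∫⁻ x, ∫⁻ y, k x y ∂μ ∂ν := by
    rw [lintegral_lintegral_swap hk.aemeasurable]
    simp only [hsymm]
  simp only [energy, lintegral_add_measure, lintegral_smul_measure, smul_eq_mul]
  rw [lintegral_add_left (h1.const_mul a), lintegral_add_left (h1.const_mul a),
    lintegral_const_mul _ h1, lintegral_const_mul _ h2, lintegral_const_mul _ h1,
    lintegral_const_mul _ h2, hswap]
  ring

/-- First variation: the energy of `(1 - t)μ + tν` is a quadratic in `t` that is smallest at `t =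
0`, so its slope there is nonnegative. -/
theorem IsEquilibriumMeasure.energy_le_mutual (hμ : IsEquilibriumMeasure k A μ)
    (hk : Measurable fun x : X × X => k x.1 x.2) (hsymm : ∀ x y, k x y = k y x)
    {ν : Measure X} (hν : IsProbabilityMeasure ν) (hνA : ν Aᶜ = 0) (hνk : energy k ν ≠ ∞) :
    energy k μ ≤ ∫⁻ x, ∫⁻ y, k x y ∂μ ∂ν := by
  have := hμ.isProbabilityMeasure
  have hI : energy k μ ≠ ∞ := ne_top_of_le_ne_top hνk (hμ.minimal ν hν hνA)
  rcases eq_or_ne (∫⁻ x, ∫⁻ y, k x y ∂μ ∂ν) ∞ with hM | hM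
  · rw [hM]; exact le_top
  have key : ∀ t : ℝ, 0 < t → t < 1 → (energy k μ).toReal ≤
      (1 - t) ^ 2 * (energy k μ).toReal + 2 * (1 - t) * t * (∫⁻ x, ∫⁻ y, k x y ∂μ ∂ν).toReal +
        t ^ 2 * (energy k ν).toReal := by
    intro t ht0 ht1
    have h1t : 0 ≤ 1 - t := by linarith
    have hp : IsProbabilityMeasure (ENNReal.ofReal (1 - t) • μ + ENNReal.ofReal t • ν) := by
      constructor
      simp only [Measure.add_apply, Measure.smul_apply, measure_univ, smul_eq_mul, mul_one]
      rw [← ENNReal.ofReal_add h1t ht0.le]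
      simp
    have h := hμ.minimal _ hp (by simp [hμ.carried, hνA])
    rw [energy_smul_add_smul hk hsymm] at h
    have h' := ENNReal.toReal_mono (by finiteness) h
    rw [ENNReal.toReal_add (by finiteness) (by finiteness),
      ENNReal.toReal_add (by finiteness) (by finiteness)] at h'
    simpa [ENNReal.toReal_mul, ENNReal.toReal_pow, ENNReal.toReal_ofReal h1t,
      ENNReal.toReal_ofReal ht0.le] using h'
  rw [← ENNReal.toReal_le_toReal hI hM]
  set i := (energy k μ).toReal with hi
  set m := (∫⁻ x, ∫⁻ y, k x y ∂μ ∂ν).toReal with hm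
  set e := (energy k ν).toReal with he
  have hi0 : 0 ≤ i := ENNReal.toReal_nonneg
  have hm0 : 0 ≤ m := ENNReal.toReal_nonneg
  have he0 : 0 ≤ e := ENNReal.toReal_nonneg
  by_contra! hlt
  have hd : 0 < i + e + 1 := by positivity
  -- If `m < i`, this `t` is small enough for the linear term `-2t(i - m)` to beat the quadratic
  -- one; the `1` in the denominator keeps `t` below `1`.
  have ht0 : 0 < (i - m) / (i + e + 1) := div_pos (by linarith) hd
  have ht1 : (i - m) / (i + e + 1) < 1 := (div_lt_one hd).2 (by linarith)
  have h := key _ ht0 ht1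
  set t := (i - m) / (i + e + 1) with ht
  have hte : t * (i + e + 1) = i - m := by rw [ht]; field_simp
  have h2 : 0 ≤ t * (t * (i + e) - 2 * (i - m) - 2 * t * m) := by nlinarith
  have h3 : t * (i + e) - 2 * (i - m) - 2 * t * m < 0 := by nlinarith [mul_nonneg ht0.le hm0]
  nlinarith [mul_pos_of_neg_of_neg (neg_neg_of_pos ht0) h3]

end Variation

/-! ### Frostman inequalities for the ring kernel and the three-point criterion -/

section RingKernel

variable {s : ℝ} {A : Set ℂ} {lam : Measure ℂ}

lemma IsKEquilibriumMeasure.ringKernel (hs0 : 0 ≤ s) (hs : s < 1) (hA : ∀ w ∈ A, 0 < w.re)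
    (h : IsKEquilibriumMeasure s A lam) : IsEquilibriumMeasure (ringKernel s) A lam :=
  IsEquilibriumMeasure.congr h fun z hz w hw => ofReal_kernelK hs0 hs (hA z hz) (hA w hw)

lemma energy_dirac (s : ℝ) (z : ℂ) :
    energy (ThreePoint.ringKernel s) (Measure.dirac z) = ThreePoint.ringKernel s z z := by
  simp [energy]

lemma IsEquilibriumMeasure.energy_ne_top (hs0 : 0 ≤ s) (hs : s < 1) (hA : ∀ w ∈ A, 0 < w.re)
    (h : IsEquilibriumMeasure (ThreePoint.ringKernel s) A lam) {z : ℂ} (hz : z ∈ A) :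
    energy (ThreePoint.ringKernel s) lam ≠ ∞ := by
  refine ((h.minimal (Measure.dirac z) inferInstance (by simp [hz])).trans_lt ?_).ne
  rw [energy_dirac]
  exact ringKernel_lt_top hs0 hs (hA z hz) (hA z hz)

/-- The potential of an equilibrium measure is at least the energy on the whole set. -/
lemma IsEquilibriumMeasure.energy_le_pot (hs0 : 0 ≤ s) (hs : s < 1) (hA : ∀ w ∈ A, 0 < w.re)
    (h : IsEquilibriumMeasure (ThreePoint.ringKernel s) A lam) {z : ℂ} (hz : z ∈ A) :
    energy (ThreePoint.ringKernel s) lam ≤ ∫⁻ w, ThreePoint.ringKernel s z w ∂lam := by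
  have := h.energy_le_mutual (measurable_ringKernel s) (ringKernel_comm s)
    (ν := Measure.dirac z) inferInstance (by simp [hz]) (by
      rw [energy_dirac]; exact (ringKernel_lt_top hs0 hs (hA z hz) (hA z hz)).ne)
  simpa using this

/-- The potential of an equilibrium measure is at most the energy on the support. -/
lemma IsEquilibriumMeasure.pot_le_energy (hs0 : 0 ≤ s) (hs : s < 1) (hAc : IsClosed A)
    (hA : ∀ w ∈ A, 0 < w.re) (h : IsEquilibriumMeasure (ThreePoint.ringKernel s) A lam) {z : ℂ}
    (hz : z ∈ lam.support) :
    ∫⁻ w, ThreePoint.ringKernel s z w ∂lam ≤ energy (ThreePoint.ringKernel s) lam := by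
  have := h.isProbabilityMeasure
  have hae : ∀ᵐ x ∂lam, x ∈ A := mem_ae_iff.2 h.carried
  have hzA : z ∈ A := Measure.support_subset_of_isClosed hAc hae hz
  by_contra! hlt
  have hpot : ∀ w : ℂ, 0 ≤ w.re →
      pot s (spin lam) (meridian w) = ∫⁻ v, ThreePoint.ringKernel s w v ∂lam := fun w hw => by
    rw [pot_spin, proj_meridian hw]
  have hnhds : {w : ℂ | energy (ThreePoint.ringKernel s) lam < pot s (spin lam) (meridian w)} ∈
      nhds z := by
    have h1 := lowerSemicontinuous_pot s (spin lam) (meridian z)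
      (energy (ThreePoint.ringKernel s) lam) (by
        change _ < pot s (spin lam) (meridian z)
        rwa [hpot z (hA z hzA).le])
    exact continuous_meridian.continuousAt.eventually h1
  have hpos := (Measure.mem_support_iff_forall z).1 hz _ hnhds
  have hmeas : Measurable fun w => ∫⁻ v, ThreePoint.ringKernel s w v ∂lam :=
    (measurable_ringKernel s).lintegral_prod_right'
  -- The potential is at least the energy almost everywhere and exceeds it on a set of positive
  -- mass, yet its integral is the energy.
  have hstrict := lintegral_strict_mono_of_ae_le_of_ae_lt_on (μ := lam)
    (f := fun _ => energy (ThreePoint.ringKernel s) lam) hmeas.aemeasurable (by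
      simpa using h.energy_ne_top hs0 hs hA hzA)
    (by filter_upwards [hae] with w hw using h.energy_le_pot hs0 hs hA hw) hpos.ne' (by
      filter_upwards [hae] with w hw hw'
      have hw'' : _ < pot s (spin lam) (meridian w) := hw'
      rwa [hpot w (hA w hw).le] at hw'')
  rw [lintegral_const, measure_univ, mul_one] at hstrict
  exact hstrict.false

/-- The three-point criterion. -/
theorem notMem_support_of_delta_pos (hs0 : 0 < s) (hs : s < 1) {x : ℝ} {z' : ℂ}
    (hA : IsAdmissible s x z' A) (hΔ : 0 < Delta s x z') (h : IsKEquilibriumMeasure s A lam) :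
    (x : ℂ) ∉ lam.support := by
  intro hx
  have hre := hA.re_pos
  have hR := h.ringKernel hs0.le hs hre
  have := hR.isProbabilityMeasure
  have hae : ∀ᵐ x ∂lam, x ∈ A := mem_ae_iff.2 hR.carried
  have hlow : ENNReal.ofReal (kernelK s x z') ≤ energy (ThreePoint.ringKernel s) lam := by
    refine le_trans ?_ (hR.pot_le_energy hs0.le hs hA.isCompact.isClosed hre hx)
    calc ENNReal.ofReal (kernelK s x z') = ∫⁻ _, ENNReal.ofReal (kernelK s x z') ∂lam := by simp
      _ ≤ _ := by
        refine lintegral_mono_ae ?_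
        filter_upwards [hae] with w hw
        rw [← ofReal_kernelK hs0.le hs (hre _ hA.mem_x) (hre w hw)]
        exact ENNReal.ofReal_le_ofReal (hA.kernel_ge w hw)
  set zc := starRingEnd ℂ z' with hzc
  have hz := hre _ hA.mem_z
  have hzc' := hre _ hA.mem_conj
  have hcc : ThreePoint.ringKernel s zc zc = ThreePoint.ringKernel s z' z' := by
    rw [← ofReal_kernelK hs0.le hs hzc' hzc', ← ofReal_kernelK hs0.le hs hz hz, kernelK_eq,
      kernelK_eq]
    simp
  have hp : IsProbabilityMeasure
      ((2⁻¹ : ℝ≥0∞) • Measure.dirac z' + (2⁻¹ : ℝ≥0∞) • Measure.dirac zc) := by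
    constructor
    simp [ENNReal.inv_two_add_inv_two]
  have hup := hR.minimal _ hp (by
    have h1 := hA.mem_z
    have h2 : zc ∈ A := hA.mem_conj
    simp [h1, h2])
  have heq : energy (ThreePoint.ringKernel s)
      ((2⁻¹ : ℝ≥0∞) • Measure.dirac z' + (2⁻¹ : ℝ≥0∞) • Measure.dirac zc) =
      ENNReal.ofReal (kernelKStar s z' z') := by
    have hn1 : 0 ≤ kernelK s z' z' := by
      unfold kernelK
      exact mul_nonneg (by positivity) (intervalIntegral.integral_nonneg (by positivity)
        fun φ _ => by positivity)
    have hn2 : 0 ≤ kernelK s z' zc := by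
      unfold kernelK
      exact mul_nonneg (by positivity) (intervalIntegral.integral_nonneg (by positivity)
        fun φ _ => by positivity)
    rw [energy_smul_add_smul (measurable_ringKernel s) (ringKernel_comm s), energy_dirac,
      energy_dirac, hcc]
    simp only [lintegral_dirac]
    rw [ringKernel_comm s zc z', kernelKStar, ← ofReal_kernelK hs0.le hs hz hz,
      ← ofReal_kernelK hs0.le hs hz hzc', show (2⁻¹ : ℝ≥0∞) = ENNReal.ofReal (1 / 2) by
        rw [one_div, ENNReal.ofReal_inv_of_pos two_pos]; simp,
      show (2 : ℝ≥0∞) = ENNReal.ofReal 2 by simp]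
    simp only [← ENNReal.ofReal_pow (by norm_num : (0 : ℝ) ≤ 1 / 2)]
    rw [← ENNReal.ofReal_mul (by norm_num), ← ENNReal.ofReal_mul (by norm_num),
      ← ENNReal.ofReal_mul (by norm_num), ← ENNReal.ofReal_mul (by norm_num),
      ← ENNReal.ofReal_add (by positivity) (by positivity),
      ← ENNReal.ofReal_add (by positivity) (by positivity)]
    congr 1
    ring
  rw [heq] at hup
  have hle := hlow.trans hup
  have hlt : kernelKStar s z' z' < kernelK s x z' := by
    unfold Delta at hΔ; linarith
  have hKS : 0 ≤ kernelKStar s z' z' := by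
    unfold kernelKStar kernelK
    have hn : ∀ a b : ℂ, 0 ≤ ∫ φ in (0 : ℝ)..(2 * Real.pi),
        1 / ‖rot φ (meridian a) - meridian b‖ ^ s := fun a b =>
      intervalIntegral.integral_nonneg (by positivity) fun φ _ => by positivity
    have := hn z' z'
    have := hn z' (starRingEnd ℂ z')
    positivity
  exact absurd hle (not_le.2 ((ENNReal.ofReal_lt_ofReal_iff_of_nonneg hKS).2 hlt))

end RingKernel

/-! ### Riesz potentials with `0 < s < 1` are strictly superharmonic -/

/-- Taylor's formula with slack `η`: right side minus left side has value and slope `0` and second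
derivative `2η` at the origin, hence a local minimum there. -/
lemma one_add_rpow_le_quadratic {t η : ℝ} (hη : 0 < η) :
    ∃ δ > 0, ∀ x : ℝ, |x| < δ →
      (1 + x) ^ (-t) ≤ 1 - t * x + (t * (t + 1) / 2 + η) * x ^ 2 := by
  set g : ℝ → ℝ := fun x => 1 - t * x + (t * (t + 1) / 2 + η) * x ^ 2 - (1 + x) ^ (-t) with hg
  have hd : ∀ (r : ℝ) (x : ℝ), -1 < x →
      HasDerivAt (fun x : ℝ => (1 + x) ^ r) (r * (1 + x) ^ (r - 1)) x := by
    intro r x hx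
    have h1 : HasDerivAt (fun x : ℝ => 1 + x) 1 x := (hasDerivAt_id x).const_add 1
    have := h1.rpow_const (p := r) (Or.inl (by linarith))
    simpa using this
  have hg1 : ∀ x : ℝ, -1 < x → HasDerivAt g
      (-t + (t * (t + 1) / 2 + η) * (2 * x) + t * (1 + x) ^ (-t - 1)) x := by
    intro x hx
    have e1 : HasDerivAt (fun x : ℝ => 1 - t * x) (-t) x := by
      simpa using ((hasDerivAt_id x).const_mul t).const_sub 1
    have e2 : HasDerivAt (fun x : ℝ => (t * (t + 1) / 2 + η) * x ^ 2)
        ((t * (t + 1) / 2 + η) * (2 * x)) x := by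
      simpa using (hasDerivAt_pow 2 x).const_mul (t * (t + 1) / 2 + η)
    refine ((e1.add e2).sub (hd (-t) x hx)).congr_deriv ?_
    ring
  have hnear : ∀ᶠ x : ℝ in nhds 0, -1 < x := lt_mem_nhds (by norm_num)
  have hderiv : deriv g =ᶠ[nhds 0] fun x =>
      -t + (t * (t + 1) / 2 + η) * (2 * x) + t * (1 + x) ^ (-t - 1) := by
    filter_upwards [hnear] with x hx using (hg1 x hx).deriv
  have hg2 : deriv (deriv g) 0 = 2 * η := by
    rw [hderiv.deriv_eq]
    have e1 : HasDerivAt (fun x : ℝ => -t + (t * (t + 1) / 2 + η) * (2 * x))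
        ((t * (t + 1) / 2 + η) * 2) 0 := by
      simpa using (((hasDerivAt_id (0 : ℝ)).const_mul 2).const_mul
        (t * (t + 1) / 2 + η)).const_add (-t)
    have e2 := (hd (-t - 1) 0 (by norm_num)).const_mul t
    refine (e1.add e2).deriv.trans ?_
    simp
    ring
  have hmin := isLocalMin_of_deriv_deriv_pos (f := g) (x₀ := 0) (by rw [hg2]; positivity)
    (by rw [(hg1 0 (by norm_num)).deriv]; simp) (hg1 0 (by norm_num)).continuousAt
  obtain ⟨δ, hδ, H⟩ := Metric.eventually_nhds_iff.1 hmin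
  refine ⟨δ, hδ, fun x hx => ?_⟩
  have := H (y := x) (by simpa using hx)
  simp only [hg, add_zero, Real.one_rpow] at this
  norm_num at this
  linarith

/-- The vectors of the standard basis of space. -/
noncomputable def axis (i : Fin 3) : E3 := EuclideanSpace.single i 1

lemma norm_add_smul_axis_sq (y : E3) (h : ℝ) (i : Fin 3) :
    ‖y + h • axis i‖ ^ 2 = ‖y‖ ^ 2 + h ^ 2 + 2 * h * y i := by
  rw [@norm_add_sq_real, norm_smul, inner_smul_right, axis]
  simp [EuclideanSpace.inner_single_right]
  ring

lemma norm_smul_axis (h : ℝ) (i : Fin 3) : ‖h • axis i‖ = |h| := by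
  simp [norm_smul, axis]

/-- The quadratic bound is applied to the increments `h² ± 2hy` of `u`; the terms linear in `y`
cancel in the sum. -/
lemma rpow_secondDiff_le {t η δ : ℝ} (H : ∀ x : ℝ, |x| < δ →
      (1 + x) ^ (-t) ≤ 1 - t * x + (t * (t + 1) / 2 + η) * x ^ 2) {u h y : ℝ} (hu : 0 < u)
    (hh : 0 < h) (hx : (h ^ 2 + 2 * h * |y|) / u < δ) (hpos : h ^ 2 + 2 * h * |y| ≤ u) :
    (u + h ^ 2 + 2 * h * y) ^ (-t) + (u + h ^ 2 - 2 * h * y) ^ (-t) ≤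
      u ^ (-t) * (2 - 2 * t * (h ^ 2 / u) +
        (t * (t + 1) + 2 * η) * (h ^ 4 / u ^ 2 + 4 * h ^ 2 * y ^ 2 / u ^ 2)) := by
  have hy := abs_nonneg y
  have hy1 := le_abs_self y
  have hy2 := neg_abs_le y
  have aux : ∀ v : ℝ, |v| ≤ h ^ 2 + 2 * h * |y| → (u + v) ^ (-t) ≤
      u ^ (-t) * (1 - t * (v / u) + (t * (t + 1) / 2 + η) * (v / u) ^ 2) := by
    intro v hv
    have h1 : |v / u| < δ := by
      rw [abs_div, abs_of_pos hu]
      exact (div_le_div_of_nonneg_right hv hu.le).trans_lt hx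
    have h2 : u + v = u * (1 + v / u) := by field_simp
    have h3 : 0 ≤ 1 + v / u := by
      have : -1 ≤ v / u := by
        rw [le_div_iff₀ hu]
        linarith [neg_abs_le v]
      linarith
    rw [h2, Real.mul_rpow hu.le h3]
    exact mul_le_mul_of_nonneg_left (H _ h1) (Real.rpow_nonneg hu.le _)
  have a1 := aux (h ^ 2 + 2 * h * y) (abs_le.2 ⟨by nlinarith, by nlinarith⟩)
  have a2 := aux (h ^ 2 - 2 * h * y) (abs_le.2 ⟨by nlinarith, by nlinarith⟩)
  rw [← add_assoc] at a1
  rw [← add_sub_assoc] at a2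
  refine (add_le_add a1 a2).trans (le_of_eq ?_)
  field_simp
  ring

/-- The sum of the second differences of a function along the three coordinate axes. -/
noncomputable def secondDiff (f : E3 → ℝ) (p : E3) (h : ℝ) : ℝ :=
  ∑ i, (f (p + h • axis i) + f (p + (-h) • axis i) - 2 * f p)

/-- The discrete sign of the Laplacian, with `v = h²/u` and `a, b, c` the ratios `y_i²/u`. The main
term is `-6t + 4t(t + 1) = -2κ`; the slack `κ/32` costs `κ/4` and the terms in `v²` cost at most
`κ/2`, leaving more than `κ` to spare. -/
lemma secondDiff_bracket_le {t κ v a b c : ℝ} (hκ0 : 0 < κ) (hκ : κ = t * (1 - 2 * t))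
    (hκ1 : κ ≤ 1 / 8) (hv0 : 0 ≤ v) (hv : v ≤ κ / 6) (habc : a + b + c ≤ 1) :
    (-2 * t * v + (t * (t + 1) + 2 * (κ / 32)) * (v ^ 2 + 4 * v * a) +
      (-2 * t * v + (t * (t + 1) + 2 * (κ / 32)) * (v ^ 2 + 4 * v * b)) +
      (-2 * t * v + (t * (t + 1) + 2 * (κ / 32)) * (v ^ 2 + 4 * v * c))) ≤ -κ * v := by
  have ht0 : 0 < t := by nlinarith
  have ht : t < 1 / 2 := by nlinarith
  set C := t * (t + 1) + 2 * (κ / 32) with hC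
  have hC0 : 0 < C := by positivity
  have hC1 : C ≤ 1 := by rw [hC]; nlinarith
  have h1 : C * (4 * v) * (a + b + c) ≤ C * (4 * v) * 1 :=
    mul_le_mul_of_nonneg_left habc (by positivity)
  have h2 : 3 * C * v ≤ κ / 2 := by
    have := mul_le_mul hC1 hv hv0 zero_le_one
    linarith
  have h3 : 3 * C * v * v ≤ κ / 2 * v := mul_le_mul_of_nonneg_right h2 hv0
  have h4 : -6 * t + 4 * C = -2 * κ + κ / 4 := by rw [hC, hκ]; ring
  have h5 : (-6 * t + 4 * C) * v = (-2 * κ + κ / 4) * v := by rw [h4]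
  have h6 : 0 ≤ κ * v := by positivity
  linarith

lemma secondDiff_rpow_le {t ε D : ℝ} (ht0 : 0 < t) (ht : t < 1 / 2) (hε : 0 < ε) :
    ∃ h₀ > 0, ∀ h : ℝ, 0 < h → h < h₀ → ∀ y : E3, ‖y‖ ^ 2 + ε ^ 2 ≤ D →
      secondDiff (fun p => (‖p‖ ^ 2 + ε ^ 2) ^ (-t)) y h ≤
        -(t * (1 - 2 * t) * D ^ (-t - 1)) * h ^ 2 := by
  set κ := t * (1 - 2 * t) with hκ
  have hκ0 : 0 < κ := mul_pos ht0 (by linarith)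
  clear_value κ
  obtain ⟨δ, hδ, H⟩ := one_add_rpow_le_quadratic (t := t) (η := κ / 32) (by positivity)
  -- With `θ = h/ε`, every increment of `u` is at most `3θu`. The bound `1/4` keeps it below `u`,
  -- `δ/3` keeps it in the Taylor range, and `κ/6` bounds `v ≤ θ² ≤ θ`. None of these depends on
  -- `y`.
  refine ⟨ε * min (min (1 / 4) (δ / 3)) (κ / 6), by positivity, fun h hh hlt y hD => ?_⟩
  set u := ‖y‖ ^ 2 + ε ^ 2 with hu
  have hu0 : 0 < u := by positivity
  set θ := h / ε with hθ
  have hθ0 : 0 < θ := by positivity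
  clear_value u θ
  have hθm : θ < min (min (1 / 4) (δ / 3)) (κ / 6) := by rw [hθ, div_lt_iff₀ hε]; linarith
  obtain ⟨hθ12, hθ3⟩ := lt_min_iff.1 hθm
  obtain ⟨hθ1, hθ2⟩ := lt_min_iff.1 hθ12
  have hhθ : h = θ * ε := by rw [hθ]; field_simp
  have hh2 : h ^ 2 ≤ θ ^ 2 * u := by
    rw [hhθ, mul_pow]
    exact mul_le_mul_of_nonneg_left (by rw [hu]; nlinarith [sq_nonneg ‖y‖]) (sq_nonneg _)
  have hyi : ∀ i, y i ^ 2 ≤ u := by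
    intro i
    rw [hu, norm_sq_eq_three]
    fin_cases i <;> simp only [Fin.zero_eta, Fin.mk_one, Fin.reduceFinMk] <;>
      nlinarith [sq_nonneg (y 0), sq_nonneg (y 1), sq_nonneg (y 2), sq_nonneg ε]
  have hhy : ∀ i, h * |y i| ≤ θ * u := by
    intro i
    refine abs_le_of_sq_le_sq' ?_ (by positivity) |>.2
    rw [mul_pow, mul_pow, sq_abs]
    calc h ^ 2 * y i ^ 2 ≤ (θ ^ 2 * u) * u := mul_le_mul hh2 (hyi i) (sq_nonneg _) (by positivity)
      _ = θ ^ 2 * u ^ 2 := by ring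
  have hθsq : θ ^ 2 ≤ θ := by nlinarith
  have hsmall : ∀ i, h ^ 2 + 2 * h * |y i| ≤ 3 * θ * u := by
    intro i
    nlinarith [hhy i, mul_le_mul_of_nonneg_right hθsq hu0.le]
  have hsum : secondDiff (fun p => (‖p‖ ^ 2 + ε ^ 2) ^ (-t)) y h ≤
      ∑ i : Fin 3, u ^ (-t) * (- 2 * t * (h ^ 2 / u) +
        (t * (t + 1) + 2 * (κ / 32)) * (h ^ 4 / u ^ 2 + 4 * h ^ 2 * y i ^ 2 / u ^ 2)) := by
    refine Finset.sum_le_sum fun i _ => ?_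
    have h1 := rpow_secondDiff_le H hu0 hh (y := y i)
      (by rw [div_lt_iff₀ hu0]; nlinarith [hsmall i]) (by nlinarith [hsmall i])
    simp only [norm_add_smul_axis_sq]
    have e1 : ‖y‖ ^ 2 + h ^ 2 + 2 * h * y i + ε ^ 2 = u + h ^ 2 + 2 * h * y i := by rw [hu]; ring
    have e2 : ‖y‖ ^ 2 + (-h) ^ 2 + 2 * (-h) * y i + ε ^ 2 = u + h ^ 2 - 2 * h * y i := by
      rw [hu]; ring
    rw [e1, e2, ← hu]
    linarith
  refine hsum.trans ?_
  rw [← Finset.mul_sum, Fin.sum_univ_three]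
  have hny : y 0 ^ 2 + y 1 ^ 2 + y 2 ^ 2 ≤ u := by rw [← norm_sq_eq_three, hu]; nlinarith
  set v := h ^ 2 / u with hv
  have hv0 : 0 < v := by positivity
  clear_value v
  have hvθ : v ≤ κ / 6 := by
    have : v ≤ θ ^ 2 := by rw [hv, div_le_iff₀ hu0]; exact hh2
    linarith
  have e3 : h ^ 4 / u ^ 2 = v ^ 2 := by rw [hv]; ring
  have e4 : ∀ i, 4 * h ^ 2 * y i ^ 2 / u ^ 2 = 4 * v * (y i ^ 2 / u) := by
    intro i; rw [hv]; field_simp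
  have e5 : y 0 ^ 2 / u + y 1 ^ 2 / u + y 2 ^ 2 / u ≤ 1 := by
    rw [← add_div, ← add_div, div_le_one hu0]; exact hny
  rw [e3, e4, e4, e4]
  have hκ1 : κ ≤ 1 / 8 := by rw [hκ]; nlinarith [sq_nonneg (4 * t - 1)]
  have hbr := secondDiff_bracket_le hκ0 hκ hκ1 hv0.le hvθ e5
  have hup := Real.rpow_pos_of_pos hu0 (-t)
  refine (mul_le_mul_of_nonneg_left hbr hup.le).trans ?_
  have hDu : D ^ (-t - 1) ≤ u ^ (-t - 1) := Real.rpow_le_rpow_of_nonpos hu0 hD (by linarith)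
  have e6 : u ^ (-t) * (-κ * v) = -(κ * u ^ (-t - 1)) * h ^ 2 := by
    rw [Real.rpow_sub_one hu0.ne', hv]
    field_simp
  rw [e6, neg_mul, neg_mul, neg_le_neg_iff]
  gcongr

/-- The regularized Riesz potential. -/
noncomputable def regPot (t ε : ℝ) (μ : Measure E3) (p : E3) : ℝ :=
  ∫ q, (‖p - q‖ ^ 2 + ε ^ 2) ^ (-t) ∂μ

lemma regKernel_le {t ε : ℝ} (ht : 0 < t) (hε : 0 < ε) (p : E3) :
    ‖(‖p‖ ^ 2 + ε ^ 2) ^ (-t)‖ ≤ (ε ^ 2) ^ (-t) := by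
  rw [Real.norm_of_nonneg (by positivity)]
  exact Real.rpow_le_rpow_of_nonpos (by positivity) (by nlinarith [sq_nonneg ‖p‖]) (by linarith)

lemma continuous_regKernel (t : ℝ) {ε : ℝ} (hε : 0 < ε) :
    Continuous fun p : E3 => (‖p‖ ^ 2 + ε ^ 2) ^ (-t) :=
  Continuous.rpow_const (by fun_prop) fun p => Or.inl (by positivity)

lemma integrable_regKernel {t ε : ℝ} (ht : 0 < t) (hε : 0 < ε) (μ : Measure E3)
    [IsFiniteMeasure μ] (p : E3) : Integrable (fun q => (‖p - q‖ ^ 2 + ε ^ 2) ^ (-t)) μ :=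
  Integrable.of_bound ((continuous_regKernel t hε).comp
    (continuous_const.sub continuous_id)).aestronglyMeasurable _
    (ae_of_all _ fun q => regKernel_le ht hε (p - q))

lemma continuous_regPot {t ε : ℝ} (ht : 0 < t) (hε : 0 < ε) (μ : Measure E3) [IsFiniteMeasure μ] :
    Continuous (regPot t ε μ) :=
  continuous_of_dominated (fun p => (integrable_regKernel ht hε μ p).aestronglyMeasurable)
    (fun p => ae_of_all _ fun q => regKernel_le ht hε (p - q)) (integrable_const _)
    (ae_of_all _ fun _ => (continuous_regKernel t hε).comp (continuous_id.sub continuous_const))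

lemma secondDiff_regPot_le {t ε D : ℝ} (ht0 : 0 < t) (hε : 0 < ε)
    (μ : Measure E3) [IsProbabilityMeasure μ] {p : E3} {h c : ℝ}
    (hq : ∀ᵐ q ∂μ, ‖p - q‖ ^ 2 + ε ^ 2 ≤ D)
    (H : ∀ y : E3, ‖y‖ ^ 2 + ε ^ 2 ≤ D →
      secondDiff (fun p => (‖p‖ ^ 2 + ε ^ 2) ^ (-t)) y h ≤ c) :
    secondDiff (regPot t ε μ) p h ≤ c := by
  have hi := integrable_regKernel ht0 hε μ
  have hadd : ∀ i : Fin 3, Integrable (fun q => (‖p + h • axis i - q‖ ^ 2 + ε ^ 2) ^ (-t) +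
      (‖p + (-h) • axis i - q‖ ^ 2 + ε ^ 2) ^ (-t)) μ := fun i => (hi _).add (hi _)
  have hsub : ∀ i : Fin 3, Integrable (fun q => (‖p + h • axis i - q‖ ^ 2 + ε ^ 2) ^ (-t) +
      (‖p + (-h) • axis i - q‖ ^ 2 + ε ^ 2) ^ (-t) - 2 * (‖p - q‖ ^ 2 + ε ^ 2) ^ (-t)) μ :=
    fun i => (hadd i).sub ((hi _).const_mul 2)
  have hterm : ∀ i : Fin 3, regPot t ε μ (p + h • axis i) + regPot t ε μ (p + (-h) • axis i) -
      2 * regPot t ε μ p = ∫ q, ((‖p + h • axis i - q‖ ^ 2 + ε ^ 2) ^ (-t) +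
        (‖p + (-h) • axis i - q‖ ^ 2 + ε ^ 2) ^ (-t) - 2 * (‖p - q‖ ^ 2 + ε ^ 2) ^ (-t)) ∂μ := by
    intro i
    rw [integral_sub (hadd i) ((hi _).const_mul 2), integral_add (hi _) (hi _), integral_const_mul]
    rfl
  unfold secondDiff
  simp only [hterm]
  rw [← integral_finsetSum _ fun i _ => hsub i]
  calc _ ≤ ∫ _, c ∂μ := by
        refine integral_mono_ae (integrable_finsetSum _ fun i _ => hsub i) (integrable_const _) ?_
        filter_upwards [hq] with q hq
        have := H (p - q) hq
        simpa only [secondDiff, sub_add_eq_add_sub] using this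
    _ = c := by simp

lemma secondDiff_norm_sq (p₀ p : E3) (h : ℝ) :
    secondDiff (fun p => ‖p - p₀‖ ^ 2) p h = 6 * h ^ 2 := by
  unfold secondDiff
  simp only [add_sub_right_comm, norm_add_smul_axis_sq]
  rw [Fin.sum_univ_three]
  ring

lemma secondDiff_add_mul (f g : E3 → ℝ) (c : ℝ) (p : E3) (h : ℝ) :
    secondDiff (fun p => f p + c * g p) p h = secondDiff f p h + c * secondDiff g p h := by
  unfold secondDiff
  rw [Finset.mul_sum, ← Finset.sum_add_distrib]
  exact Finset.sum_congr rfl fun i _ => by ring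

/-- A regularized potential drops by a definite amount somewhere on each sphere. -/
lemma exists_regPot_add_le {t : ℝ} (ht0 : 0 < t) (ht : t < 1 / 2) (μ : Measure E3)
    [IsProbabilityMeasure μ] {R : ℝ} (hμ : ∀ᵐ q ∂μ, ‖q‖ ≤ R) (p₀ : E3) {r : ℝ} (hr : 0 < r) :
    ∃ d > 0, ∀ ε : ℝ, 0 < ε → ε ≤ 1 → ∃ p ∈ Metric.sphere p₀ r,
      regPot t ε μ p + d ≤ regPot t ε μ p₀ := by
  set D := (‖p₀‖ + r + |R|) ^ 2 + 1 with hD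
  have hD0 : 0 < D := by positivity
  set κ := t * (1 - 2 * t) * D ^ (-t - 1) with hκ
  have hκ0 : 0 < κ := mul_pos (mul_pos ht0 (by linarith)) (Real.rpow_pos_of_pos hD0 _)
  refine ⟨κ / 12 * r ^ 2, by positivity, fun ε hε hε1 => ?_⟩
  obtain ⟨h₀, hh₀, H⟩ := secondDiff_rpow_le ht0 ht hε (D := D)
  -- The added paraboloid has second difference `κh²/2`, less than the drop `κh²` of the potential.
  -- So `V` has no minimum inside the ball, and its minimum on the sphere gives the drop `κr²/12`,
  -- independent of `ε`.
  set V : E3 → ℝ := fun p => regPot t ε μ p + κ / 12 * ‖p - p₀‖ ^ 2 with hV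
  have hVc : Continuous V := (continuous_regPot ht0 hε μ).add (by fun_prop)
  obtain ⟨p, hp, hmin⟩ := (isCompact_closedBall p₀ r).exists_isMinOn
    (Metric.nonempty_closedBall.2 hr.le) hVc.continuousOn
  have hp' : ‖p - p₀‖ ≤ r := by simpa [dist_eq_norm] using hp
  have hV0 : V p ≤ V p₀ := hmin (Metric.mem_closedBall_self hr.le)
  have hsph : ‖p - p₀‖ = r := by
    refine le_antisymm hp' (not_lt.1 fun hlt => ?_)
    set h := min (h₀ / 2) (r - ‖p - p₀‖) with hh
    have hh0 : 0 < h := lt_min (by positivity) (by linarith)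
    have hh1 : h < h₀ := (min_le_left _ _).trans_lt (by linarith)
    have hh2 : h ≤ r - ‖p - p₀‖ := min_le_right _ _
    have hge : 0 ≤ secondDiff V p h := by
      refine Finset.sum_nonneg fun i _ => ?_
      have hmem : ∀ a : ℝ, |a| = h → V p ≤ V (p + a • axis i) := by
        intro a ha
        refine hmin ?_
        rw [Metric.mem_closedBall, dist_eq_norm, add_sub_right_comm]
        refine (norm_add_le _ _).trans ?_
        rw [norm_smul_axis, ha]
        linarith
      have h1 := hmem h (abs_of_pos hh0)
      have h2 := hmem (-h) (by rw [abs_neg, abs_of_pos hh0])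
      linarith
    have hle : secondDiff (regPot t ε μ) p h ≤ -κ * h ^ 2 := by
      refine secondDiff_regPot_le ht0 hε μ (D := D) ?_ (H h hh0 hh1)
      filter_upwards [hμ] with q hq
      have h1 : ‖p - q‖ ≤ ‖p₀‖ + r + |R| := by
        calc ‖p - q‖ = ‖(p - p₀) + p₀ - q‖ := by simp
          _ ≤ ‖p - p₀‖ + ‖p₀‖ + ‖q‖ := (norm_sub_le _ _).trans (by gcongr; exact norm_add_le _ _)
          _ ≤ _ := by linarith [le_abs_self R]
      have h2 : ‖p - q‖ ^ 2 ≤ (‖p₀‖ + r + |R|) ^ 2 := by gcongr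
      rw [hD]
      nlinarith
    rw [hV, secondDiff_add_mul, secondDiff_norm_sq] at hge
    nlinarith [mul_pos hκ0 (sq_pos_of_pos hh0)]
  refine ⟨p, by simpa [dist_eq_norm] using hsph, ?_⟩
  simp only [hV, hsph, sub_self, norm_zero] at hV0
  linarith

lemma rieszKernel_eq_sq (s : ℝ) (p q : E3) :
    rieszKernel s p q = (ENNReal.ofReal (‖p - q‖ ^ 2)) ^ (-(s / 2)) := by
  rw [rieszKernel, ENNReal.ofReal_pow (norm_nonneg _), ← ENNReal.rpow_natCast, ← ENNReal.rpow_mul]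
  congr 1
  push_cast; ring

lemma ofReal_regPot {t ε : ℝ} (ht : 0 < t) (hε : 0 < ε) (μ : Measure E3) [IsFiniteMeasure μ]
    (p : E3) : ENNReal.ofReal (regPot t ε μ p) =
      ∫⁻ q, (ENNReal.ofReal (‖p - q‖ ^ 2 + ε ^ 2)) ^ (-t) ∂μ := by
  rw [regPot, ofReal_integral_eq_lintegral_ofReal (integrable_regKernel ht hε μ p)
    (ae_of_all _ fun q => by positivity)]
  refine lintegral_congr fun q => ?_
  rw [ENNReal.ofReal_rpow_of_pos (by positivity)]

/-- The strict superharmonicity of a Riesz potential, as the absence of local minima. -/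
theorem exists_pot_lt {s : ℝ} (hs0 : 0 < s) (hs : s < 1) (μ : Measure E3)
    [IsProbabilityMeasure μ] {R : ℝ} (hμ : ∀ᵐ q ∂μ, ‖q‖ ≤ R) {p₀ : E3} {r : ℝ} (hr : 0 < r)
    (hfin : pot s μ p₀ ≠ ∞) : ∃ p ∈ Metric.sphere p₀ r, pot s μ p < pot s μ p₀ := by
  obtain ⟨d, hd, H⟩ := exists_regPot_add_le (t := s / 2) (by linarith) (by linarith) μ hμ p₀ hr
  set ε : ℕ → ℝ := fun n => 1 / ((n : ℝ) + 1) with hε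
  have hε0 : ∀ n, 0 < ε n := fun n => by simp only [hε]; positivity
  have hε1 : ∀ n, ε n ≤ 1 := fun n => by
    simp only [hε]
    rw [div_le_one (by positivity)]
    linarith [(Nat.cast_nonneg n : (0 : ℝ) ≤ n)]
  have hεt : Filter.Tendsto ε Filter.atTop (nhds 0) := tendsto_one_div_add_atTop_nhds_zero_nat
  choose u hu hud using fun n => H (ε n) (hε0 n) (hε1 n)
  obtain ⟨p, hp, φ, hφ, hlim⟩ := (isCompact_sphere p₀ r).tendsto_subseq hu
  refine ⟨p, hp, ?_⟩
  -- Regularization only lowers the kernel, so the true potential bounds the regularized one at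
  -- `p₀`. At the limit point `p`, Fatou's lemma gives the inequality in the opposite direction.
  have hle : ∀ n, ENNReal.ofReal (regPot (s / 2) (ε n) μ (u n)) + ENNReal.ofReal d ≤ pot s μ p₀ := by
    intro n
    have hnn : 0 ≤ regPot (s / 2) (ε n) μ (u n) := integral_nonneg fun q => by positivity
    rw [← ENNReal.ofReal_add hnn hd.le]
    refine (ENNReal.ofReal_le_ofReal (hud n)).trans ?_
    rw [ofReal_regPot (by linarith) (hε0 n)]
    refine lintegral_mono fun q => ?_
    rw [rieszKernel_eq_sq]
    rw [ENNReal.rpow_neg, ENNReal.rpow_neg, ENNReal.inv_le_inv]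
    exact ENNReal.rpow_le_rpow (ENNReal.ofReal_le_ofReal (by nlinarith [hε0 n])) (by linarith)
  have hpot : pot s μ p ≤
      Filter.liminf (fun n => ENNReal.ofReal (regPot (s / 2) (ε (φ n)) μ (u (φ n)))) Filter.atTop := by
    simp only [ofReal_regPot (by linarith : 0 < s / 2) (hε0 _)]
    calc pot s μ p = ∫⁻ q, Filter.liminf (fun n => (ENNReal.ofReal
          (‖u (φ n) - q‖ ^ 2 + ε (φ n) ^ 2)) ^ (-(s / 2))) Filter.atTop ∂μ := by
          refine lintegral_congr fun q => (Filter.Tendsto.liminf_eq ?_).symm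
          rw [rieszKernel_eq_sq]
          refine (ENNReal.continuous_rpow_const.tendsto _).comp
            ((ENNReal.continuous_ofReal.tendsto _).comp ?_)
          have h1 := ((hlim.sub_const q).norm.pow 2).add ((hεt.comp hφ.tendsto_atTop).pow 2)
          simpa using h1
      _ ≤ _ := lintegral_liminf_le fun n => by fun_prop
  have hadd : pot s μ p + ENNReal.ofReal d ≤ pot s μ p₀ := by
    have h1 : pot s μ p ≤ pot s μ p₀ - ENNReal.ofReal d := by
      refine hpot.trans (Filter.liminf_le_of_le (by isBoundedDefault) fun b hb => ?_)
      obtain ⟨n, hn⟩ := hb.exists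
      exact hn.trans (ENNReal.le_sub_of_add_le_right ENNReal.ofReal_ne_top (hle _))
    have h2 : ENNReal.ofReal d ≤ pot s μ p₀ := le_trans le_add_self (hle 0)
    calc _ ≤ pot s μ p₀ - ENNReal.ofReal d + ENNReal.ofReal d := by gcongr
      _ = _ := tsub_add_cancel_of_le h2
  have hpfin : pot s μ p ≠ ∞ := ne_top_of_le_ne_top hfin (le_self_add.trans hadd)
  exact (ENNReal.lt_add_right hpfin (by simpa using hd)).trans_le hadd

/-! ### The Riesz kernel is positive definite -/

section PositiveDefinite

variable {X Ω : Type*} [MeasurableSpace X] [MeasurableSpace Ω]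

lemma mutualEnergy_eq_of_factor {m : Measure Ω} [SFinite m] {W : Ω → ℝ≥0∞} (hW : Measurable W)
    {F : Ω → X → ℝ≥0∞} (hF : Measurable fun x : Ω × X => F x.1 x.2) {k : X → X → ℝ≥0∞}
    (hk : ∀ x y, k x y = ∫⁻ ω, W ω * (F ω x * F ω y) ∂m) (μ ν : Measure X) [SFinite μ] [SFinite ν] :
    ∫⁻ x, ∫⁻ y, k x y ∂ν ∂μ = ∫⁻ ω, W ω * ((∫⁻ x, F ω x ∂μ) * ∫⁻ y, F ω y ∂ν) ∂m := by
  have hFω : ∀ ω, Measurable (F ω) := fun ω => hF.comp measurable_prodMk_left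
  have hFx : ∀ x, Measurable fun ω => F ω x := fun x => hF.comp measurable_prodMk_right
  have hFν : Measurable fun ω => ∫⁻ y, F ω y ∂ν := hF.lintegral_prod_right'
  have h1 : ∀ x, ∫⁻ y, k x y ∂ν = ∫⁻ ω, W ω * (F ω x * ∫⁻ y, F ω y ∂ν) ∂m := by
    intro x
    simp only [hk]
    rw [lintegral_lintegral_swap]
    · refine lintegral_congr fun ω => ?_
      rw [lintegral_const_mul _ ((hFω ω).const_mul _), lintegral_const_mul _ (hFω ω)]
    · have e1 : Measurable fun y : X × Ω => F y.2 y.1 := hF.comp measurable_swap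
      have e2 : Measurable fun y : X × Ω => F y.2 x := (hFx x).comp measurable_snd
      exact ((hW.comp measurable_snd).mul (e2.mul e1)).aemeasurable
  simp only [h1]
  rw [lintegral_lintegral_swap]
  · refine lintegral_congr fun ω => ?_
    rw [lintegral_const_mul _ ((hFω ω).mul_const _), lintegral_mul_const _ (hFω ω)]
  · have e1 : Measurable fun y : X × Ω => F y.2 y.1 := hF.comp measurable_swap
    exact ((hW.comp measurable_snd).mul (e1.mul (hFν.comp measurable_snd))).aemeasurable

lemma ennreal_two_mul_mul_le (a b : ℝ≥0∞) : 2 * (a * b) ≤ a * a + b * b := by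
  rcases eq_or_ne a ∞ with rfl | ha
  · simp
  rcases eq_or_ne b ∞ with rfl | hb
  · simp
  lift a to NNReal using ha
  lift b to NNReal using hb
  norm_cast
  rw [← NNReal.coe_le_coe]
  push_cast
  nlinarith [sq_nonneg ((a : ℝ) - b)]

/-- Positive definiteness without subtraction: `2ab ≤ a² + b²` under the integral over `ω`. This
form remains valid for infinite energies. -/
lemma two_mul_mutualEnergy_le_of_factor {m : Measure Ω} [SFinite m] {W : Ω → ℝ≥0∞}
    (hW : Measurable W) {F : Ω → X → ℝ≥0∞} (hF : Measurable fun x : Ω × X => F x.1 x.2)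
    {k : X → X → ℝ≥0∞} (hk : ∀ x y, k x y = ∫⁻ ω, W ω * (F ω x * F ω y) ∂m)
    (μ ν : Measure X) [SFinite μ] [SFinite ν] :
    2 * ∫⁻ x, ∫⁻ y, k x y ∂ν ∂μ ≤ energy k μ + energy k ν := by
  have hFμ : Measurable fun ω => ∫⁻ y, F ω y ∂μ := hF.lintegral_prod_right'
  have hFν : Measurable fun ω => ∫⁻ y, F ω y ∂ν := hF.lintegral_prod_right'
  have h1 : Measurable fun ω => W ω * ((∫⁻ x, F ω x ∂μ) * ∫⁻ y, F ω y ∂ν) := hW.mul (hFμ.mul hFν)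
  have h2 : Measurable fun ω => W ω * ((∫⁻ x, F ω x ∂μ) * ∫⁻ y, F ω y ∂μ) := hW.mul (hFμ.mul hFμ)
  rw [energy, energy, mutualEnergy_eq_of_factor hW hF hk, mutualEnergy_eq_of_factor hW hF hk,
    mutualEnergy_eq_of_factor hW hF hk, ← lintegral_const_mul _ h1, ← lintegral_add_left h2]
  refine lintegral_mono fun ω => ?_
  calc 2 * (W ω * ((∫⁻ x, F ω x ∂μ) * ∫⁻ y, F ω y ∂ν)) =
        W ω * (2 * ((∫⁻ x, F ω x ∂μ) * ∫⁻ y, F ω y ∂ν)) := by ring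
    _ ≤ W ω * ((∫⁻ x, F ω x ∂μ) * (∫⁻ x, F ω x ∂μ) + (∫⁻ x, F ω x ∂ν) * (∫⁻ x, F ω x ∂ν)) := by
        gcongr
        exact ennreal_two_mul_mul_le _ _
    _ = _ := by ring

end PositiveDefinite

lemma lintegral_rpow_mul_exp_of_pos {t r : ℝ} (ht : 0 < t) (hr : 0 < r) :
    ∫⁻ τ in Set.Ioi (0 : ℝ), ENNReal.ofReal (τ ^ (t - 1) * Real.exp (-(r * τ))) =
      ENNReal.ofReal (Real.Gamma t) * ENNReal.ofReal r ^ (-t) := by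
  have key := Real.integral_rpow_mul_exp_neg_mul_Ioi ht hr
  have hG := Real.Gamma_pos_of_pos ht
  have hint : IntegrableOn (fun τ : ℝ => τ ^ (t - 1) * Real.exp (-(r * τ))) (Set.Ioi 0) :=
    .of_integral_ne_zero (by rw [key]; positivity)
  rw [← ofReal_integral_eq_lintegral_ofReal hint, key, ENNReal.ofReal_rpow_of_pos hr,
    ← ENNReal.ofReal_mul hG.le, one_div, Real.inv_rpow hr.le, Real.rpow_neg hr.le, mul_comm]
  filter_upwards [ae_restrict_mem measurableSet_Ioi] with τ hτ
  have : 0 < τ := hτ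
  positivity

lemma lintegral_rpow_mul_exp {t r : ℝ} (ht : 0 < t) (hr : 0 ≤ r) :
    ∫⁻ τ in Set.Ioi (0 : ℝ), ENNReal.ofReal (τ ^ (t - 1) * Real.exp (-(r * τ))) =
      ENNReal.ofReal (Real.Gamma t) * ENNReal.ofReal r ^ (-t) := by
  rcases hr.eq_or_lt with rfl | hr
  · have hG := Real.Gamma_pos_of_pos ht
    -- At `r = 0` both sides are infinite: the integral dominates those with `r = 1/(n + 1)`, whose
    -- values blow up. This covers the diagonal of the Riesz kernel.
    have hlim : Filter.Tendsto (fun n : ℕ => ENNReal.ofReal (Real.Gamma t) *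
        ENNReal.ofReal (1 / ((n : ℝ) + 1)) ^ (-t)) Filter.atTop
        (nhds (ENNReal.ofReal (Real.Gamma t) * ENNReal.ofReal 0 ^ (-t))) := by
      refine ENNReal.Tendsto.const_mul ?_ (Or.inr ENNReal.ofReal_ne_top)
      exact (ENNReal.continuous_rpow_const.tendsto _).comp
        ((ENNReal.continuous_ofReal.tendsto _).comp tendsto_one_div_add_atTop_nhds_zero_nat)
    have htop : ENNReal.ofReal (Real.Gamma t) * ENNReal.ofReal 0 ^ (-t) = ∞ := by
      rw [ENNReal.ofReal_zero, ENNReal.zero_rpow_of_neg (by linarith), ENNReal.mul_top]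
      simpa using hG
    rw [htop, ← top_le_iff, ← htop]
    refine le_of_tendsto' hlim fun n => ?_
    rw [← lintegral_rpow_mul_exp_of_pos ht (by positivity)]
    refine setLIntegral_mono' measurableSet_Ioi fun τ hτ => ENNReal.ofReal_le_ofReal ?_
    have hτ0 : 0 < τ := hτ
    have : 0 ≤ 1 / ((n : ℝ) + 1) * τ := by positivity
    gcongr
    positivity
  · exact lintegral_rpow_mul_exp_of_pos ht hr

/-- The Gaussian normalization. -/
noncomputable def gaussMass (τ : ℝ) : ℝ≥0∞ := ∫⁻ y : E3, ENNReal.ofReal (Real.exp (-(4 * τ) * ‖y‖ ^ 2))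

lemma measurable_gaussMass : Measurable gaussMass := by
  refine Measurable.lintegral_prod_right' (f := fun x : ℝ × E3 =>
    ENNReal.ofReal (Real.exp (-(4 * x.1) * ‖x.2‖ ^ 2))) ?_
  fun_prop

lemma gaussMass_ne {τ : ℝ} (hτ : 0 < τ) : gaussMass τ ≠ 0 ∧ gaussMass τ ≠ ∞ := by
  have key := GaussianFourier.integral_rexp_neg_mul_sq_norm (V := E3) (b := 4 * τ) (by positivity)
  have hpos : 0 < ∫ v : E3, Real.exp (-(4 * τ) * ‖v‖ ^ 2) := by rw [key]; positivity
  have hint : Integrable fun v : E3 => Real.exp (-(4 * τ) * ‖v‖ ^ 2) :=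
    .of_integral_ne_zero hpos.ne'
  rw [gaussMass, ← ofReal_integral_eq_lintegral_ofReal hint (ae_of_all _ fun _ => Real.exp_nonneg _)]
  exact ⟨by simpa using hpos, ENNReal.ofReal_ne_top⟩

/-- With midpoint `c`, `|p - y|² + |q - y|² = |p - q|²/2 + 2|y - c|²`; translation invariance then
removes `c`. -/
lemma lintegral_gauss_mul (τ : ℝ) (p q : E3) :
    ∫⁻ y : E3, ENNReal.ofReal (Real.exp (-(2 * τ * ‖p - y‖ ^ 2))) *
      ENNReal.ofReal (Real.exp (-(2 * τ * ‖q - y‖ ^ 2))) =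
      ENNReal.ofReal (Real.exp (-(‖p - q‖ ^ 2 * τ))) * gaussMass τ := by
  set c : E3 := (1 / 2 : ℝ) • (p + q) with hc
  have h : ∀ y : E3, ENNReal.ofReal (Real.exp (-(2 * τ * ‖p - y‖ ^ 2))) *
      ENNReal.ofReal (Real.exp (-(2 * τ * ‖q - y‖ ^ 2))) =
      ENNReal.ofReal (Real.exp (-(‖p - q‖ ^ 2 * τ))) *
        ENNReal.ofReal (Real.exp (-(4 * τ) * ‖y - c‖ ^ 2)) := by
    intro y
    rw [← ENNReal.ofReal_mul (Real.exp_nonneg _), ← ENNReal.ofReal_mul (Real.exp_nonneg _),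
      ← Real.exp_add, ← Real.exp_add]
    congr 2
    simp only [norm_sq_eq_three, hc, PiLp.sub_apply, PiLp.smul_apply, PiLp.add_apply, smul_eq_mul]
    ring
  simp only [h]
  rw [lintegral_const_mul _ (by fun_prop), gaussMass,
    lintegral_sub_right_eq_self (fun y : E3 => ENNReal.ofReal (Real.exp (-(4 * τ) * ‖y‖ ^ 2))) c]

/-- The Riesz kernel as a mixture of products of Gaussians. -/
lemma rieszKernel_eq_lintegral {s : ℝ} (hs : 0 < s) (p q : E3) :
    rieszKernel s p q = ∫⁻ ω : ℝ × E3,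
      ((ENNReal.ofReal (Real.Gamma (s / 2)))⁻¹ * ENNReal.ofReal (ω.1 ^ (s / 2 - 1)) *
        (gaussMass ω.1)⁻¹) * (ENNReal.ofReal (Real.exp (-(2 * ω.1 * ‖p - ω.2‖ ^ 2))) *
          ENNReal.ofReal (Real.exp (-(2 * ω.1 * ‖q - ω.2‖ ^ 2))))
      ∂((volume.restrict (Set.Ioi (0 : ℝ))).prod volume) := by
  have ht : 0 < s / 2 := by positivity
  have hG := Real.Gamma_pos_of_pos ht
  have hG0 : ENNReal.ofReal (Real.Gamma (s / 2)) ≠ 0 := by simpa using hG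
  have hgm := measurable_gaussMass
  rw [lintegral_prod _ (by fun_prop)]
  have h1 : ∀ τ ∈ Set.Ioi (0 : ℝ), (∫⁻ y : E3,
      ((ENNReal.ofReal (Real.Gamma (s / 2)))⁻¹ * ENNReal.ofReal (τ ^ (s / 2 - 1)) *
        (gaussMass τ)⁻¹) * (ENNReal.ofReal (Real.exp (-(2 * τ * ‖p - y‖ ^ 2))) *
          ENNReal.ofReal (Real.exp (-(2 * τ * ‖q - y‖ ^ 2))))) =
      (ENNReal.ofReal (Real.Gamma (s / 2)))⁻¹ *
        ENNReal.ofReal (τ ^ (s / 2 - 1) * Real.exp (-(‖p - q‖ ^ 2 * τ))) := by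
    intro τ hτ
    have hτ0 : 0 < τ := hτ
    obtain ⟨h0, h1⟩ := gaussMass_ne hτ0
    rw [lintegral_const_mul _ (by fun_prop), lintegral_gauss_mul,
      ENNReal.ofReal_mul (by positivity)]
    calc _ = (ENNReal.ofReal (Real.Gamma (s / 2)))⁻¹ * (ENNReal.ofReal (τ ^ (s / 2 - 1)) *
          ENNReal.ofReal (Real.exp (-(‖p - q‖ ^ 2 * τ)))) * ((gaussMass τ)⁻¹ * gaussMass τ) := by
          ring
      _ = _ := by rw [ENNReal.inv_mul_cancel h0 h1, mul_one]
  rw [setLIntegral_congr_fun measurableSet_Ioi h1, lintegral_const_mul _ (by fun_prop),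
    lintegral_rpow_mul_exp ht (sq_nonneg _), ← mul_assoc,
    ENNReal.inv_mul_cancel hG0 ENNReal.ofReal_ne_top, one_mul, rieszKernel_eq_sq]

theorem two_mul_mutualEnergy_riesz_le {s : ℝ} (hs : 0 < s) (μ ν : Measure E3) [SFinite μ]
    [SFinite ν] : 2 * ∫⁻ p, ∫⁻ q, rieszKernel s p q ∂ν ∂μ ≤
      energy (rieszKernel s) μ + energy (rieszKernel s) ν := by
  have hgm := measurable_gaussMass
  refine two_mul_mutualEnergy_le_of_factor (Ω := ℝ × E3)
    (W := fun ω => (ENNReal.ofReal (Real.Gamma (s / 2)))⁻¹ * ENNReal.ofReal (ω.1 ^ (s / 2 - 1)) *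
        (gaussMass ω.1)⁻¹)
    (F := fun ω p => ENNReal.ofReal (Real.exp (-(2 * ω.1 * ‖p - ω.2‖ ^ 2)))) ?_ ?_
    (rieszKernel_eq_lintegral hs) μ ν
  · fun_prop
  · fun_prop

/-! ### Reduction of the problem in space to the half-plane -/

lemma continuous_rot_left (φ : ℝ) : Continuous (rot φ) :=
  continuous_rot.comp (continuous_const.prodMk continuous_id)

lemma energy_map_rot (s φ : ℝ) (μ : Measure E3) [SFinite μ] :
    energy (rieszKernel s) (μ.map (rot φ)) = energy (rieszKernel s) μ := by
  have hr := (continuous_rot_left φ).measurable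
  have h1 : energy (rieszKernel s) (μ.map (rot φ)) = ∫⁻ p, pot s (μ.map (rot φ)) p ∂(μ.map (rot φ)) :=
    rfl
  rw [h1, lintegral_map (measurable_pot s _) hr]
  refine lintegral_congr fun p => ?_
  rw [pot, lintegral_map (measurable_rieszKernel_right s _) hr]
  simp only [rieszKernel_rot_rot]

lemma measurable_ringKernel_right (s : ℝ) (z : ℂ) : Measurable (ringKernel s z) :=
  Measurable.of_uncurry_left (f := ringKernel s) (measurable_ringKernel s)

/-- The energy of the projection is the mean over `φ` of the mutual energies of `μ` and its rotated
copies. Each is at most the energy of `μ`, by positive definiteness and rotation invariance. -/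
lemma energy_map_proj_le {s : ℝ} (hs : 0 < s) (μ : Measure E3) [IsProbabilityMeasure μ] :
    energy (ringKernel s) (μ.map proj) ≤ energy (rieszKernel s) μ := by
  have hp := continuous_proj.measurable
  have h1 : energy (ringKernel s) (μ.map proj) =
      ∫⁻ φ, ∫⁻ p, ∫⁻ q, rieszKernel s (rot φ p) q ∂μ ∂μ ∂angleMeasure := by
    have hm1 : Measurable fun z => ∫⁻ w, ringKernel s z w ∂(μ.map proj) :=
      (measurable_ringKernel s).lintegral_prod_right'
    rw [energy, lintegral_map hm1 hp]
    have hrot : Measurable fun x : ℝ × E3 => rot x.1 x.2 := continuous_rot.measurable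
    have h2 : ∀ p, ∫⁻ w, ringKernel s (proj p) w ∂(μ.map proj) =
        ∫⁻ φ, ∫⁻ q, rieszKernel s (rot φ p) q ∂μ ∂angleMeasure := by
      intro p
      rw [lintegral_map (measurable_ringKernel_right s (proj p)) hp]
      simp only [ringKernel_proj]
      rw [lintegral_lintegral_swap]
      have e1 : Measurable fun x : E3 × ℝ => rot x.2 p :=
        hrot.comp (measurable_snd.prodMk measurable_const)
      exact (e1.rieszKernel measurable_fst s).aemeasurable
    simp only [h2]
    rw [lintegral_lintegral_swap]
    have e2 : Measurable fun x : (E3 × ℝ) × E3 => rot x.1.2 x.1.1 :=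
      hrot.comp ((measurable_snd.comp measurable_fst).prodMk (measurable_fst.comp measurable_fst))
    exact (e2.rieszKernel measurable_snd s).lintegral_prod_right'.aemeasurable
  have h3 : ∀ φ, 2 * ∫⁻ p, ∫⁻ q, rieszKernel s (rot φ p) q ∂μ ∂μ ≤
      2 * energy (rieszKernel s) μ := by
    intro φ
    have hr := (continuous_rot_left φ).measurable
    have h4 : ∫⁻ p, ∫⁻ q, rieszKernel s (rot φ p) q ∂μ ∂μ =
        ∫⁻ p, ∫⁻ q, rieszKernel s p q ∂μ ∂(μ.map (rot φ)) :=
      (lintegral_map (measurable_pot s μ) hr).symm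
    rw [h4]
    refine (two_mul_mutualEnergy_riesz_le hs (μ.map (rot φ)) μ).trans ?_
    rw [energy_map_rot, two_mul]
  rw [h1]
  calc _ ≤ ∫⁻ _, energy (rieszKernel s) μ ∂angleMeasure := by
        refine lintegral_mono fun φ => ?_
        exact (ENNReal.mul_le_mul_iff_right two_ne_zero ENNReal.ofNat_ne_top).1 (h3 φ)
    _ = _ := by simp

lemma ae_spin_of_ae {lam : Measure ℂ} [SFinite lam] {P : E3 → Prop} {A : Set ℂ}
    (hP : MeasurableSet {p | P p}) (hlam : ∀ᵐ z ∂lam, z ∈ A)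
    (h : ∀ z ∈ A, ∀ φ, P (rot φ (meridian z))) : ∀ᵐ p ∂(spin lam), P p := by
  rw [spin, ae_map_iff measurable_rot_meridian.aemeasurable hP]
  filter_upwards [Measure.quasiMeasurePreserving_snd.ae hlam] with x hx using h _ hx _

/-- The projection of a Riesz equilibrium measure of a set of revolution is an equilibrium measure
of the generating set. -/
theorem IsRieszEquilibriumMeasure.map_proj {s : ℝ} (hs : 0 < s) {A : Set ℂ} (hAm : MeasurableSet A)
    (hA : ∀ w ∈ A, 0 < w.re) {μ : Measure E3}
    (h : IsRieszEquilibriumMeasure s (revolve A) μ) :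
    IsEquilibriumMeasure (ringKernel s) A (μ.map proj) := by
  have hp := continuous_proj.measurable
  have := h.isProbabilityMeasure
  rw [IsRieszEquilibriumMeasure, revolve_eq hA] at h
  refine ⟨Measure.isProbabilityMeasure_map hp.aemeasurable, ?_, fun ν hν hνA => ?_⟩
  · rw [Measure.map_apply hp hAm.compl]
    exact h.carried
  · rw [← energy_spin ν hA hνA]
    refine (energy_map_proj_le hs μ).trans (h.minimal _ inferInstance ?_)
    exact mem_ae_iff.1 (ae_spin_of_ae (P := fun p => proj p ∈ A) (hp hAm) (mem_ae_iff.2 hνA)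
      fun z hz φ => by rwa [proj_rot, proj_meridian (hA z hz).le])

/-! ### Equilibrium measures do not charge the interior -/

lemma norm_rot_meridian (φ : ℝ) (z : ℂ) : ‖rot φ (meridian z)‖ = ‖z‖ := by
  rw [← sq_eq_sq₀ (norm_nonneg _) (norm_nonneg _), norm_sq_eq_three, ← Complex.normSq_eq_norm_sq,
    Complex.normSq_apply]
  simp only [rot_apply_zero, rot_apply_one, rot_apply_two, meridian_apply_zero,
    meridian_apply_one, meridian_apply_two]
  nlinarith [Real.sin_sq_add_cos_sq φ]

theorem IsEquilibriumMeasure.notMem_support_of_mem_interior {s : ℝ} (hs0 : 0 < s) (hs : s < 1)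
    {A : Set ℂ} (hAc : IsCompact A) (hA : ∀ w ∈ A, 0 < w.re) {lam : Measure ℂ}
    (h : IsEquilibriumMeasure (ThreePoint.ringKernel s) A lam) {z : ℂ} (hz : z ∈ interior A) :
    z ∉ lam.support := by
  intro hsupp
  have := h.isProbabilityMeasure
  have hzA := interior_subset hz
  have hU := h.pot_le_energy hs0.le hs hAc.isClosed hA hsupp
  have hpot : pot s (spin lam) (meridian z) = ∫⁻ w, ThreePoint.ringKernel s z w ∂lam := by
    rw [pot_spin, proj_meridian (hA z hzA).le]
  have hfin := ne_top_of_le_ne_top (h.energy_ne_top hs0.le hs hA hzA) hU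
  obtain ⟨R, hR⟩ := hAc.isBounded.exists_norm_le
  have hbd : ∀ᵐ q ∂(spin lam), ‖q‖ ≤ R :=
    ae_spin_of_ae (measurableSet_le measurable_norm measurable_const) (mem_ae_iff.2 h.carried)
      fun w hw φ => by rw [norm_rot_meridian]; exact hR w hw
  have hnh : proj ⁻¹' interior A ∈ nhds (meridian z) :=
    (isOpen_interior.preimage continuous_proj).mem_nhds (by
      rwa [Set.mem_preimage, proj_meridian (hA z hzA).le])
  obtain ⟨r, hr, hball⟩ := Metric.nhds_basis_closedBall.mem_iff.1 hnh
  obtain ⟨p, hp, hlt⟩ := exists_pot_lt hs0 hs (spin lam) hbd (p₀ := meridian z) hr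
    (by rwa [hpot])
  have hpA : proj p ∈ A := interior_subset (hball (Metric.sphere_subset_closedBall hp))
  have h1 := h.energy_le_pot hs0.le hs hA hpA
  rw [← pot_spin] at h1
  rw [hpot] at hlt
  exact absurd (h1.trans_lt hlt) (not_lt.2 hU)

/-! ### Boundaries -/

/-- A ray inside the complement puts its starting point in an unbounded component, so the set
defining the outer boundary is the whole complement. -/
lemma outerBoundary_eq_frontier {X : Type*} [NormedAddCommGroup X] [NormedSpace ℝ X] {B : Set X}
    (h : ∀ p ∉ B, ∃ v : X, v ≠ 0 ∧ ∀ t : ℝ, 0 ≤ t → p + t • v ∉ B) :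
    outerBoundary B = frontier B := by
  have : {p | p ∈ Bᶜ ∧ ¬ Bornology.IsBounded (connectedComponentIn Bᶜ p)} = Bᶜ := by
    refine Set.Subset.antisymm (fun p hp => hp.1) fun p hp => ⟨hp, fun hb => ?_⟩
    obtain ⟨v, hv, hray⟩ := h p hp
    set S : Set X := (fun t : ℝ => p + t • v) '' Set.Ici 0
    have hS : IsPreconnected S :=
      isPreconnected_Ici.image _ (by fun_prop)
    have hSB : S ⊆ Bᶜ := by
      rintro _ ⟨t, ht, rfl⟩
      exact hray t ht
    have hsub := hS.subset_connectedComponentIn (x := p) ⟨0, by simp, by simp⟩ hSB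
    obtain ⟨C, hC⟩ := (hb.subset hsub).exists_norm_le
    have hC0 : 0 ≤ C := (norm_nonneg _).trans (hC p ⟨0, by simp, by simp⟩)
    have hv0 : 0 < ‖v‖ := norm_pos_iff.2 hv
    have ht : 0 ≤ (C + ‖p‖ + 1) / ‖v‖ := by positivity
    have h1 := hC _ ⟨(C + ‖p‖ + 1) / ‖v‖, ht, rfl⟩
    have h2 : ‖((C + ‖p‖ + 1) / ‖v‖) • v‖ = C + ‖p‖ + 1 := by
      rw [norm_smul, Real.norm_of_nonneg ht]; field_simp
    have h3 := norm_sub_norm_le (((C + ‖p‖ + 1) / ‖v‖) • v) (-p)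
    rw [sub_neg_eq_add, norm_neg, add_comm _ p, h2] at h3
    linarith
  rw [outerBoundary, this, frontier_compl]

lemma support_ssubset_frontier {X : Type*} [TopologicalSpace X] [MeasurableSpace X]
    {B : Set X} (hB : IsClosed B) {μ : Measure X} (hμ : μ Bᶜ = 0)
    (hint : ∀ p ∈ interior B, p ∉ μ.support) {p : X} (hp : p ∈ B) (hp' : p ∉ interior B)
    (hps : p ∉ μ.support) : μ.support ⊂ frontier B := by
  rw [hB.frontier_eq]
  refine Set.ssubset_iff_subset_ne.2 ⟨fun q hq => ⟨?_, fun hq' => hint q hq' hq⟩, fun he => hps ?_⟩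
  · exact Measure.support_subset_of_isClosed hB (mem_ae_iff.2 hμ) hq
  · rw [he]; exact ⟨hp, hp'⟩

/-- Pulling back along the half-plane slice through `p` suffices; openness of `proj` is not needed.
-/
lemma proj_mem_interior {A : Set ℂ} (hA : ∀ w ∈ A, 0 < w.re) {p : E3}
    (hp : p ∈ interior (proj ⁻¹' A)) : proj p ∈ interior A := by
  have hpA : p ∈ proj ⁻¹' A := interior_subset hp
  rw [Set.mem_preimage] at hpA
  obtain ⟨α, -, hα⟩ := exists_rot_eq p
  have hc : Continuous fun w => rot α (meridian w) := (continuous_rot_left α).comp continuous_meridian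
  rw [mem_interior_iff_mem_nhds] at hp ⊢
  have h1 : ∀ᶠ w in nhds (proj p), rot α (meridian w) ∈ proj ⁻¹' A :=
    hc.continuousAt.eventually (by simp only [← hα]; exact hp)
  have h2 : ∀ᶠ w : ℂ in nhds (proj p), 0 < w.re :=
    Complex.continuous_re.continuousAt.eventually (lt_mem_nhds (hA _ hpA))
  filter_upwards [h1, h2] with w hw hw0
  rwa [Set.mem_preimage, proj_rot, proj_meridian hw0.le] at hw

/-! ### The washer -/

lemma isCompact_washerSection : IsCompact washerSection :=
  (isCompact_Icc (a := (1 / 2 : ℝ)) (b := 1)).reProdIm (isCompact_Icc (a := -(1 / 2 : ℝ)) (b := 1 / 2))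

lemma washerSection_re_pos : ∀ w ∈ washerSection, 0 < w.re := fun w hw => by
  linarith [hw.1.1]

lemma isAdmissible_washerSection {s : ℝ} (hs0 : 0 < s) (hs : s < 1) :
    IsAdmissible s (1 / 2) (⟨1, 1 / 2⟩ : ℂ) washerSection where
  isCompact := isCompact_washerSection
  re_pos := washerSection_re_pos
  kernel_ge w hw := by
    have hx : 0 < (((1 / 2 : ℝ) : ℝ) : ℂ).re := by norm_num
    have hw0 := washerSection_re_pos w hw
    have hnn : 0 ≤ kernelK s ((1 / 2 : ℝ) : ℂ) w := by
      unfold kernelK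
      exact mul_nonneg (by positivity) (intervalIntegral.integral_nonneg (by positivity)
        fun φ _ => by positivity)
    rw [← ENNReal.ofReal_le_ofReal_iff hnn, ofReal_kernelK hs0.le hs hx (by norm_num),
      ofReal_kernelK hs0.le hs hx hw0]
    refine lintegral_mono fun φ => ?_
    unfold rieszKernel
    rw [ENNReal.rpow_neg, ENNReal.rpow_neg, ENNReal.inv_le_inv]
    refine ENNReal.rpow_le_rpow (ENNReal.ofReal_le_ofReal ?_) hs0.le
    rw [← sq_le_sq₀ (norm_nonneg _) (norm_nonneg _), norm_rot_meridian_sub_sq,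
      norm_rot_meridian_sub_sq]
    obtain ⟨⟨h1, h2⟩, h3, h4⟩ := hw
    simp only [Complex.ofReal_re, Complex.ofReal_im]
    -- For each angle the squared distance at `z'` exceeds that at `w` by `(1 - re w)(1 + re w - cos
    -- φ) + (1/4 - (im w)²) ≥ 0`: the corner is farthest from every point of the orbit.
    nlinarith [mul_nonneg (sub_nonneg.2 h2) (by linarith [Real.cos_le_one φ] :
      0 ≤ 1 + w.re - Real.cos φ)]
  mem_x := by
    refine ⟨⟨?_, ?_⟩, ?_, ?_⟩ <;> norm_num
  mem_z := by
    refine ⟨⟨?_, ?_⟩, ?_, ?_⟩ <;> norm_num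
  mem_conj := by
    refine ⟨⟨?_, ?_⟩, ?_, ?_⟩ <;> norm_num

lemma half_notMem_interior : ((1 / 2 : ℝ) : ℂ) ∉ interior washerSection := by
  intro h
  rw [mem_interior_iff_mem_nhds] at h
  have hlim : Filter.Tendsto (fun n : ℕ => (((1 / 2 : ℝ) - 1 / ((n : ℝ) + 1) : ℝ) : ℂ)) Filter.atTop
      (nhds ((1 / 2 : ℝ) : ℂ)) := by
    refine (Complex.continuous_ofReal.tendsto _).comp ?_
    simpa using (tendsto_const_nhds (x := (1 / 2 : ℝ))).sub
      (tendsto_one_div_add_atTop_nhds_zero_nat (𝕜 := ℝ))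
  obtain ⟨n, hn⟩ := (hlim.eventually h).exists
  have h1 := hn.1.1
  rw [Complex.ofReal_re] at h1
  have : 0 < 1 / ((n : ℝ) + 1) := by positivity
  linarith

lemma outerBoundary_washerSection : outerBoundary washerSection = frontier washerSection := by
  refine outerBoundary_eq_frontier fun p hp => ?_
  rcases le_total 0 p.im with h | h
  · refine ⟨Complex.I, Complex.I_ne_zero, fun t ht hmem => hp ?_⟩
    obtain ⟨h1, h2, h3⟩ := hmem
    simp only [Complex.add_re, Complex.add_im, Complex.smul_re, Complex.smul_im, Complex.I_re,
      Complex.I_im, smul_eq_mul, mul_zero, mul_one, add_zero] at h1 h2 h3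
    exact ⟨h1, by linarith, by linarith⟩
  · refine ⟨-Complex.I, neg_ne_zero.2 Complex.I_ne_zero, fun t ht hmem => hp ?_⟩
    obtain ⟨h1, h2, h3⟩ := hmem
    simp only [Complex.add_re, Complex.add_im, Complex.smul_re, Complex.smul_im, Complex.neg_re,
      Complex.neg_im, Complex.I_re, Complex.I_im, smul_eq_mul, neg_zero, mul_zero, mul_neg,
      mul_one, add_zero] at h1 h2 h3
    exact ⟨h1, by linarith, by linarith⟩

lemma proj_add_smul_axis (p : E3) (t : ℝ) :
    proj (p + t • axis 1) = ⟨(proj p).re, (proj p).im + t⟩ := by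
  apply Complex.ext <;> simp [proj, axis]

lemma outerBoundary_washer : outerBoundary (revolve washerSection) =
    frontier (revolve washerSection) := by
  refine outerBoundary_eq_frontier fun p hp => ?_
  rw [revolve_eq washerSection_re_pos] at hp ⊢
  have hax : axis 1 ≠ 0 := fun h => by
    have := norm_smul_axis 1 1
    rw [h] at this
    simp at this
  rcases le_total 0 (proj p).im with h | h
  · refine ⟨axis 1, hax, fun t ht hmem => hp ?_⟩
    rw [Set.mem_preimage, proj_add_smul_axis] at hmem
    obtain ⟨h1, h2, h3⟩ := hmem
    exact ⟨h1, by linarith, by simp only at h3; linarith⟩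
  · refine ⟨-axis 1, neg_ne_zero.2 hax, fun t ht hmem => hp ?_⟩
    rw [Set.mem_preimage, smul_neg, ← neg_smul, proj_add_smul_axis] at hmem
    obtain ⟨h1, h2, h3⟩ := hmem
    exact ⟨h1, by simp only at h2; linarith, by linarith⟩

end ThreePoint

/-! ### Proof of the three-point theorem -/

theorem theorem3p4 :
    -- (a)
    (∀ (s x : ℝ) (z' : ℂ) (A : Set ℂ), 0 < s → s < 1 → 0 < x → 0 < z'.re →
      ThreePoint.IsAdmissible s x z' A → 0 < ThreePoint.Delta s x z' →
      ∀ lam : MeasureTheory.Measure ℂ, ThreePoint.IsKEquilibriumMeasure s A lam →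
        (x : ℂ) ∉ lam.support) ∧
    -- (b)
    (∀ x γ : ℝ, 0 < x → 0 < γ →
      (√((1 + x) ^ 2 + γ ^ 2) + √((1 - x) ^ 2 + γ ^ 2)) ^ 2 < 4 * (γ + √(1 + γ ^ 2)) →
      ∃ s₀ : ℝ, 0 < s₀ ∧ s₀ ≤ 1 ∧ ∀ s : ℝ, 0 < s → s < s₀ →
        0 < ThreePoint.Delta s x (⟨1, γ⟩ : ℂ) ∧
        ∀ A : Set ℂ, ThreePoint.IsAdmissible s x (⟨1, γ⟩ : ℂ) A →
          ∀ lam : MeasureTheory.Measure ℂ, ThreePoint.IsKEquilibriumMeasure s A lam →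
            (x : ℂ) ∉ lam.support) ∧
    -- (c), with the example of the washer, in the half-plane and in space
    (∀ s : ℝ, 0 < s → s < 1 / 3 →
      0 < ThreePoint.Delta s (1 / 2) (⟨1, 1 / 2⟩ : ℂ) ∧
      (∀ A : Set ℂ, ThreePoint.IsAdmissible s (1 / 2) (⟨1, 1 / 2⟩ : ℂ) A →
        ∀ lam : MeasureTheory.Measure ℂ, ThreePoint.IsKEquilibriumMeasure s A lam →
          ((1 / 2 : ℝ) : ℂ) ∉ lam.support) ∧
      (∀ lam : MeasureTheory.Measure ℂ,
        ThreePoint.IsKEquilibriumMeasure s ThreePoint.washerSection lam →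
          ((1 / 2 : ℝ) : ℂ) ∉ lam.support ∧
          lam.support ⊂ ThreePoint.outerBoundary ThreePoint.washerSection) ∧
      (∀ μ : MeasureTheory.Measure (EuclideanSpace ℝ (Fin 3)),
        ThreePoint.IsRieszEquilibriumMeasure s
            (ThreePoint.revolve ThreePoint.washerSection) μ →
          μ.support ⊂
            ThreePoint.outerBoundary (ThreePoint.revolve ThreePoint.washerSection))) := by
  refine ⟨fun s x z' A hs0 hs _ _ hA hΔ lam h =>
      ThreePoint.notMem_support_of_delta_pos hs0 hs hA hΔ h, fun x γ hx hγ hlt => ?_,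
    fun s hs0 hs => ?_⟩
  · obtain ⟨s₀, h0, h1, H⟩ := ThreePoint.exists_delta_pos hx hγ hlt
    exact ⟨s₀, h0, h1, fun s hs0 hs => ⟨H s hs0 hs, fun A hA lam h =>
      ThreePoint.notMem_support_of_delta_pos hs0 (hs.trans_le h1) hA (H s hs0 hs) h⟩⟩
  have hs1 : s < 1 := by linarith
  have hΔ := ThreePoint.delta_washer_pos hs0 hs
  have hre := ThreePoint.washerSection_re_pos
  have hcl := ThreePoint.isCompact_washerSection.isClosed
  have hadm := ThreePoint.isAdmissible_washerSection hs0 hs1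
  refine ⟨hΔ, fun A hA lam h => ThreePoint.notMem_support_of_delta_pos hs0 hs1 hA hΔ h,
    fun lam h => ?_, fun μ h => ?_⟩
  · have hhalf := ThreePoint.notMem_support_of_delta_pos hs0 hs1 hadm hΔ h
    refine ⟨hhalf, ?_⟩
    rw [ThreePoint.outerBoundary_washerSection]
    exact ThreePoint.support_ssubset_frontier hcl h.carried
      (fun p hp => (h.ringKernel hs0.le hs1 hre).notMem_support_of_mem_interior hs0 hs1
        ThreePoint.isCompact_washerSection hre hp) hadm.mem_x ThreePoint.half_notMem_interior hhalf
  · have hR := h.map_proj hs0 hcl.measurableSet hre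
    have hK : ThreePoint.IsKEquilibriumMeasure s ThreePoint.washerSection (μ.map ThreePoint.proj) :=
      hR.congr fun z hz w hw => (ThreePoint.ofReal_kernelK hs0.le hs1 (hre z hz) (hre w hw)).symm
    have hhalf := ThreePoint.notMem_support_of_delta_pos hs0 hs1 hadm hΔ hK
    -- Continuity of `proj` sends the support of `μ` into that of its image. The exclusions of `1/2`
    -- and of interior points thus lift to space.
    have hsupp : ∀ p ∈ μ.support, ThreePoint.proj p ∈ (μ.map ThreePoint.proj).support := by
      intro p hp
      rw [MeasureTheory.Measure.mem_support_iff_forall] at hp ⊢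
      intro U hU
      have h1 := hp _ (ThreePoint.continuous_proj.continuousAt.preimage_mem_nhds hU)
      exact h1.trans_le (MeasureTheory.Measure.le_map_apply
        ThreePoint.continuous_proj.aemeasurable U)
    have hpre := ThreePoint.revolve_eq hre
    have hmer : ThreePoint.proj (ThreePoint.meridian ((1 / 2 : ℝ) : ℂ)) = ((1 / 2 : ℝ) : ℂ) :=
      ThreePoint.proj_meridian (by norm_num)
    rw [ThreePoint.outerBoundary_washer]
    have hc := h.carried
    rw [hpre] at hc ⊢
    refine ThreePoint.support_ssubset_frontier (hcl.preimage ThreePoint.continuous_proj) hc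
      (fun p hp hps => hR.notMem_support_of_mem_interior hs0 hs1
        ThreePoint.isCompact_washerSection hre (ThreePoint.proj_mem_interior hre hp)
        (hsupp p hps)) (p := ThreePoint.meridian ((1 / 2 : ℝ) : ℂ)) ?_ ?_ ?_
    · rw [Set.mem_preimage, hmer]; exact hadm.mem_x
    · intro hp
      have := ThreePoint.proj_mem_interior hre hp
      rw [hmer] at this
      exact ThreePoint.half_notMem_interior this
    · intro hp
      have := hsupp _ hp
      rw [hmer] at this
      exact hhalf this
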